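/- Let $M_i^{n_i}$, $1\le i\le r$, be smooth Riemannian manifolds of dimensions $n_i\ge 2$ and let $f_i\colon M_i^{n_i}\to\mathbb{R}^{n_i+p_i}$ be smooth isometric immersions. Put $n=\sum_i n_i$, $p=\sum_i p_i$, let $M^n=M_1^{n_1}\times\cdots\times M_r^{n_r}$ be the Riemannian product, and let $f\colon M^n\to\mathbb{R}^{n+p}=\bigoplus_{i=1}^r\mathbb{R}^{n_i+p_i}$ be the extrinsic product of the $f_i$, that is, $f(x)=(f_1(x_1),\dots,f_r(x_r))$ for $x=(x_1,\dots,x_r)$. For an isometric immersion $h\colon N\to\mathbb{R}^m$ with normal spaces $N_hN(x)$ and second fundamental form $\alpha$, the $s$-nullity at $x\in N$, $1\le s\le m-\dim N$, is $$\nu_s(x)=\max\{\dim\mathcal N(\alpha_U)(x)\colon U\subset N_hN(x)\text{ a subspace},\ \dim U=s\},$$ where $\mathcal N(\alpha_U)(x)=\{Y\in T_xN\colon \pi_U\,\alpha(Y,X)=0\text{ for all }X\in T_xN\}$ and $\pi_U$ is the orthogonal projection onto $U$. An infinitesimal bending of $h$ is a smooth map $\mathcal T\colon N\to\mathbb{R}^m$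 (a section of $h^*T\mathbb{R}^m$) such that $\langle \mathcal T_*X,h_*Y\rangle+\langle h_*X,\mathcal T_*Y\rangle=0$ for all $X,Y\in T_xN$ and all $x\in N$; it is trivial if $\mathcal T=\mathcal D h+v$ with a skew-symmetric endomorphism $\mathcal D$ of $\mathbb{R}^m$ and $v\in\mathbb{R}^m$. Assume that $p<n$ and that the $s$-nullities of $f$ satisfy $\nu_s(x)<n-s$ for all $1\le s\le p$ and all $x\in M^n$. Then every infinitesimal bending $\mathcal T$ of $f$ is, locally and up to a trivial infinitesimal bending, a sum of infinitesimal bendings of the factors: for every $x^0\in M^n$ there are open neighborhoods $U_i\subset M_i$ of $x_i^0$, infinitesimal bendings $\mathcal T_i$ of $f_i|_{U_i}$, $1\le i\le r$, and a trivial infinitesimal bending $\mathcal S$ of $f$ such that $$\mathcal T(x)=\sum_{i=1}^r\tilde\iota_i\,\mathcal T_i(x_i)+\mathcal S(x)\qquad\text{for all }x\in U_1\times\cdots\times U_r,$$ where $\tilde\iota_i\colon\mathbb{R}^{n_i+p_i}\to\mathbb{R}^{n+p}$ is the inclusion of the $i$-th summand. -/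

import Mathlib

open scoped Manifold ContDiff

noncomputable section

namespace InfinitesimalBending

section Immersions

variable {E : Type*} [NormedAddCommGroup E] [NormedSpace ℝ E]
  {H : Type*} [TopologicalSpace H] (I : ModelWithCorners ℝ E H)
  {M : Type*} [TopologicalSpace M] [ChartedSpace H M]
  {V : Type*} [NormedAddCommGroup V] [InnerProductSpace ℝ V]

/-- The differential `f_* : T_x M → V` of a map into a Euclidean space, whose tangent spaces are
identified with `V`. -/
def differential (f : M → V) (x : M) : TangentSpace I x →L[ℝ] V :=
  mfderiv I 𝓘(ℝ, V) f x

/-- `f` is an isometric immersion of the Riemannian manifold `(M, g)` into the Euclidean space `V`: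
it is smooth and `⟨f_* X, f_* Y⟩ = g(X, Y)` for all tangent vectors `X, Y`.
(It is then an immersion, since `g` is positive definite.) -/
def IsIsometricImmersion [IsManifold I 1 M]
    (g : Bundle.ContMDiffRiemannianMetric I ∞ E (fun x : M => TangentSpace I x))
    (f : M → V) : Prop :=
  ContMDiff I 𝓘(ℝ, V) ∞ f ∧
    ∀ (x : M) (X Y : TangentSpace I x),
      inner ℝ (differential I f x X) (differential I f x Y) = g.inner x X Y

/-- `T`, a section over the open set `U` of the pull-back `f^* TV` (that is, a map into `V`), is an
infinitesimal bending of the restriction of `f` to `U`: it is smooth on `U` and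
`⟨T_* X, f_* Y⟩ + ⟨f_* X, T_* Y⟩ = 0` for all `X, Y` tangent to `M` at points of `U`.
The values of `T` outside `U` play no role. -/
def IsInfinitesimalBendingOn (f T : M → V) (U : Set M) : Prop :=
  ContMDiffOn I 𝓘(ℝ, V) ∞ T U ∧
    ∀ x ∈ U, ∀ X Y : TangentSpace I x,
      inner ℝ (differential I T x X) (differential I f x Y) +
        inner ℝ (differential I f x X) (differential I T x Y) = 0

/-- `T` is an infinitesimal bending of `f : M → V`. -/
def IsInfinitesimalBending (f T : M → V) : Prop :=
  IsInfinitesimalBendingOn I f T Set.univ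

/-- `T` is a trivial infinitesimal bending of `f`: the restriction to `f` of a Killing field of `V`,
that is, `T = D f + v` with a skew-symmetric endomorphism `D` and a vector `v`. -/
def IsTrivialBending (f T : M → V) : Prop :=
  ∃ (D : V →ₗ[ℝ] V) (v : V), (∀ a b : V, inner ℝ (D a) b = -inner ℝ a (D b)) ∧
    ∀ x, T x = D (f x) + v

/-- The normal space `N_f M(x)`, the orthogonal complement of `f_* T_x M` in `V`. -/
def normalSpace (f : M → V) (x : M) : Submodule ℝ V :=
  (differential I f x).rangeᗮ

/-- The second derivative at `x` of `f`, read in the preferred chart at `x`, as a bilinear map on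
`T_x M` (which the preferred chart identifies with the model space `E`). -/
def chartHessian (f : M → V) (x : M) : TangentSpace I x →ₗ[ℝ] TangentSpace I x →ₗ[ℝ] V :=
  (ContinuousLinearMap.toLinearMap₁₂
    (fderivWithin ℝ (fderivWithin ℝ (f ∘ (extChartAt I x).symm) (Set.range I)) (Set.range I)
      (extChartAt I x x)) : E →ₗ[ℝ] E →ₗ[ℝ] V)

variable [FiniteDimensional ℝ V]

/-- The second fundamental form `α(X, Y) = (∇̃_X f_* Y)_{N_f M}` of `f` at `x`.
Extend `Y` to the local field with constant components in the preferred chart `φ` at `x`. Then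
`f_* Y` reads `D(f ∘ φ⁻¹) Y` in this chart, so that `∇̃_X f_* Y` at `x` is the second derivative of
`f ∘ φ⁻¹` at `φ x` applied to `X` and `Y`. Another extension of `Y` changes `∇̃_X f_* Y` by a
tangent vector only, which the projection to the normal space removes. -/
def secondFundamentalForm (f : M → V) (x : M) :
    TangentSpace I x →ₗ[ℝ] TangentSpace I x →ₗ[ℝ] V :=
  (chartHessian I f x).compr₂ (normalSpace I f x).starProjection.toLinearMap

/-- The nullity space `𝒩(α_U)(x) = {Y ∈ T_x M : α_U(Y, X) = 0 for all X ∈ T_x M}`, where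
`α_U = π_U ∘ α` and `π_U` is the orthogonal projection onto `U`. -/
def nullitySpace (f : M → V) (x : M) (U : Submodule ℝ V) : Submodule ℝ (TangentSpace I x) where
  carrier := {Y | ∀ X : TangentSpace I x,
    U.starProjection (secondFundamentalForm I f x Y X) = 0}
  zero_mem' X := by simp
  add_mem' {Y Z} hY hZ X := by
    rw [map_add, LinearMap.add_apply, map_add, hY X, hZ X, add_zero]
  smul_mem' c Y hY X := by
    rw [map_smul, LinearMap.smul_apply, map_smul, hY X, smul_zero]

/-- The `s`-nullity `ν_s(x)` of `f`: the largest dimension of `𝒩(α_U)(x)`, where `U` runs over the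
`s`-dimensional subspaces of the normal space `N_f M(x)`. (For finite-dimensional `M` and
`s ≤ dim N_f M(x)` this is the maximum of a non-empty bounded set of natural numbers.) -/
def sNullity (f : M → V) (x : M) (s : ℕ) : ℕ :=
  sSup {d : ℕ | ∃ U : Submodule ℝ V, U ≤ normalSpace I f x ∧ Module.finrank ℝ U = s ∧
    d = Module.finrank ℝ (nullitySpace I f x U)}

end Immersions

/-- The extrinsic product `f(x) = (f₁(x₁), …, f_r(x_r))` of maps `f_i : M_i → V_i`, with values in
the orthogonal direct sum of the `V_i`. -/
def extrinsicProduct {ι : Type*} {M : ι → Type*} {V : ι → Type*}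
    (f : ∀ i, M i → V i) (x : ∀ i, M i) : PiLp 2 V :=
  WithLp.toLp 2 fun i => f i (x i)

end InfinitesimalBending

end

/-! The nullity bounds are used only through an algebraic consequence, `NondegenerateAt`, for each
factor. Let `B` be a normal-valued one-form on the `i`-th tangent space with `⟨α(W, X), B Z⟩`
symmetric in `W` and `Z`. Extend it by zero to the product and let `U` be its image, of dimension
`s`. Its kernel has dimension `n - s` and lies in the nullity space of `α_U`, so `s ≥ 1` would
contradict `ν_s < n - s`. Hence `B = 0` (`nondegenerateAt_of_sNullity`).

Work in charts on a product of balls, with `F i` the factors and `G i` the components of the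
bending. For `i ≠ j`, the derivative of `G i` along the `j`-th factor is, as a function of the
`i`-th variable, again a bending of `F i`. By the off-diagonal bending equation its tangent
component is a gradient. Such a bending is constant: its derivative pairs with the tangent space
both symmetrically and skew-symmetrically, hence is normal, and one more differentiation makes it a
form killed by nondegeneracy (`fderiv_eq_zero_of_bending_of_gradient`, `fderiv_single_update`).

So the mixed second differences of `G i` involving the `i`-th variable vanish. The off-diagonal
equations then integrate to identities between increments of `G` and chords of `F`, and a symmetry
argument removes the second differences in two other variables (`second_difference_eq_zero_of_ne`).
Thus `G i` is a sum of functions of one variable. For `j ≠ i` the summand in the `j`-th variable is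
a linear map `D i j` of the chord of `F j`, because chords are total, and the blocks satisfy `D i j
= -(D j i)*`. Together they form the skew endomorphism of the trivial bending; the summand in the
`i`-th variable is the bending of the factor (`exists_skew`). -/

noncomputable section

namespace InfinitesimalBending

/-! ### Nondegenerate maps and their bendings with gradient tangent component. -/

section Nondegenerate

variable {E : Type*} [NormedAddCommGroup E] [NormedSpace ℝ E]
  {V : Type*} [NormedAddCommGroup V] [InnerProductSpace ℝ V]

/-- The algebraic form of the nullity assumption: the only normal-valued one-form `B` for which
`⟨D²F(W, X), B Z⟩` is symmetric in `W` and `Z` is zero. -/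
def NondegenerateAt (F : E → V) (y : E) : Prop :=
  ∀ B : E →ₗ[ℝ] V, (∀ X Z, inner ℝ (fderiv ℝ F y X) (B Z) = 0) →
    (∀ W X Z, inner ℝ (fderiv ℝ (fderiv ℝ F) y W X) (B Z) =
      inner ℝ (fderiv ℝ (fderiv ℝ F) y Z X) (B W)) → B = 0

theorem fderiv_clm_apply_const {F' : Type*} [NormedAddCommGroup F'] [NormedSpace ℝ F']
    {E' : Type*} [NormedAddCommGroup E'] [NormedSpace ℝ E']
    {A : E → E' →L[ℝ] F'} {y : E} (hA : DifferentiableAt ℝ A y) (X : E') (Z : E) :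
    fderiv ℝ (fun z => A z X) y Z = fderiv ℝ A y Z X := by
  have := (hA.hasFDerivAt.clm_apply (hasFDerivAt_const X y)).fderiv
  rw [this]; simp

theorem contDiffOn_fderiv_of_isOpen {F' : Type*} [NormedAddCommGroup F'] [NormedSpace ℝ F']
    {F : E → F'} {W : Set E} (hW : IsOpen W)
    (hF : ContDiffOn ℝ ∞ F W) : ContDiffOn ℝ ∞ (fderiv ℝ F) W :=
  hF.fderiv_of_isOpen hW (by simp)

theorem fderiv_fderiv_symm {F' : Type*} [NormedAddCommGroup F'] [NormedSpace ℝ F']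
    {F : E → F'} {W : Set E} (hW : IsOpen W) (hF : ContDiffOn ℝ ∞ F W)
    {y : E} (hy : y ∈ W) (X Y : E) :
    fderiv ℝ (fderiv ℝ F) y X Y = fderiv ℝ (fderiv ℝ F) y Y X :=
  ((hF.contDiffAt (hW.mem_nhds hy)).isSymmSndFDerivAt
    (by rw [minSmoothness_of_isRCLikeNormedField]; exact WithTop.coe_le_coe.2 le_top)) X Y

theorem differentiableAt_of_contDiffOn_isOpen {F' : Type*} [NormedAddCommGroup F']
    [NormedSpace ℝ F'] {F : E → F'} {W : Set E} (hW : IsOpen W)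
    (hF : ContDiffOn ℝ ∞ F W) {y : E} (hy : y ∈ W) : DifferentiableAt ℝ F y :=
  (hF.contDiffAt (hW.mem_nhds hy)).differentiableAt (by simp)

/-- An infinitesimal bending `S` of `F` whose tangent component is a gradient is constant. -/
theorem fderiv_eq_zero_of_bending_of_gradient {F S : E → V} {θ : E → ℝ} {W : Set E}
    (hW : IsOpen W) (hF : ContDiffOn ℝ ∞ F W) (hS : ContDiffOn ℝ ∞ S W)
    (hθ : ContDiffOn ℝ ∞ θ W) (hnd : ∀ y ∈ W, NondegenerateAt F y)
    (hb : ∀ y ∈ W, ∀ X Z, inner ℝ (fderiv ℝ S y X) (fderiv ℝ F y Z) +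
      inner ℝ (fderiv ℝ F y X) (fderiv ℝ S y Z) = 0)
    (hg : ∀ y ∈ W, ∀ X, inner ℝ (fderiv ℝ F y X) (S y) = fderiv ℝ θ y X)
    {y : E} (hy : y ∈ W) : fderiv ℝ S y = 0 := by
  have hF' := contDiffOn_fderiv_of_isOpen hW hF
  have hS' := contDiffOn_fderiv_of_isOpen hW hS
  have hθ' := contDiffOn_fderiv_of_isOpen hW hθ
  have dc {G' : Type _} [NormedAddCommGroup G'] [NormedSpace ℝ G'] {A : E → E →L[ℝ] G'} {y : E}
      (hA : DifferentiableAt ℝ A y) (X : E) : DifferentiableAt ℝ (fun z => A z X) y :=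
    hA.clm_apply (differentiableAt_const X)
  -- The bending equation says that this form is skew in `X, Z`. Differentiating the gradient
  -- equation expresses it through the Hessians of `θ` and `F`, so it is also symmetric.
  have normal : ∀ y ∈ W, ∀ X Z, inner ℝ (fderiv ℝ F y X) (fderiv ℝ S y Z) = 0 := by
    intro y hy X Z
    have hFd := differentiableAt_of_contDiffOn_isOpen hW hF' hy
    have hSd := differentiableAt_of_contDiffOn_isOpen hW hS hy
    have hθd := differentiableAt_of_contDiffOn_isOpen hW hθ' hy
    have key : ∀ X Z, inner ℝ (fderiv ℝ F y X) (fderiv ℝ S y Z) +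
        inner ℝ (fderiv ℝ (fderiv ℝ F) y Z X) (S y) = fderiv ℝ (fderiv ℝ θ) y Z X := by
      intro X Z
      have e : (fun z => inner ℝ (fderiv ℝ F z X) (S z)) =ᶠ[nhds y] fun z => fderiv ℝ θ z X :=
        Filter.eventually_of_mem (hW.mem_nhds hy) fun z hz => hg z hz X
      have e' := congrArg (fun A => A Z) (e.fderiv_eq (𝕜 := ℝ))
      rwa [fderiv_inner_apply ℝ (dc hFd X) hSd, fderiv_clm_apply_const hFd,
        fderiv_clm_apply_const hθd] at e'
    have k1 := key X Z
    have k2 := key Z X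
    rw [fderiv_fderiv_symm hW hF hy X Z, fderiv_fderiv_symm hW hθ hy X Z] at k2
    have k3 := hb y hy X Z
    rw [real_inner_comm] at k3
    linarith
  have hFd := differentiableAt_of_contDiffOn_isOpen hW hF' hy
  have hSd := differentiableAt_of_contDiffOn_isOpen hW hS' hy
  -- Differentiated orthogonality. Since the second derivative of `S` is symmetric in `W'` and `Z`,
  -- the other term is too, so nondegeneracy applies to `B = dS`.
  have key : ∀ W' X Z, inner ℝ (fderiv ℝ F y X) (fderiv ℝ (fderiv ℝ S) y W' Z) +
      inner ℝ (fderiv ℝ (fderiv ℝ F) y W' X) (fderiv ℝ S y Z) = 0 := by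
    intro W' X Z
    have e : (fun z => inner ℝ (fderiv ℝ F z X) (fderiv ℝ S z Z)) =ᶠ[nhds y] fun z => (0 : ℝ) :=
      Filter.eventually_of_mem (hW.mem_nhds hy) fun z hz => normal z hz X Z
    have e' := congrArg (fun A => A W') (e.fderiv_eq (𝕜 := ℝ))
    rw [fderiv_inner_apply ℝ (dc hFd X) (dc hSd Z), fderiv_clm_apply_const hFd,
        fderiv_clm_apply_const hSd] at e'
    rw [e']; simp
  have := hnd y hy (fderiv ℝ S y : E →ₗ[ℝ] V) (fun X Z => normal y hy X Z) (fun W' X Z => by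
    have k1 := key W' X Z
    have k2 := key Z X W'
    rw [fderiv_fderiv_symm hW hS hy Z W'] at k2
    simp only [ContinuousLinearMap.coe_coe]
    linarith)
  exact ContinuousLinearMap.coe_injective this

/-- A vector orthogonal to all chords from a base point vanishes. -/
theorem eq_zero_of_orthogonal_chords [Nontrivial E] {F : E → V} {W : Set E}
    (hW : IsOpen W) (hF : ContDiffOn ℝ ∞ F W) {o : E} (ho : o ∈ W) (hnd : NondegenerateAt F o)
    {c : V} (hc : ∀ y ∈ W, inner ℝ c (F y - F o) = 0) : c = 0 := by
  have hF' := contDiffOn_fderiv_of_isOpen hW hF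
  have h1 : ∀ y ∈ W, ∀ X, inner ℝ c (fderiv ℝ F y X) = 0 := by
    intro y hy X
    have e : (fun z => inner ℝ c (F z - F o)) =ᶠ[nhds y] fun z => (0 : ℝ) :=
      Filter.eventually_of_mem (hW.mem_nhds hy) fun z hz => hc z hz
    have e' := congrArg (fun A => A X) (e.fderiv_eq (𝕜 := ℝ))
    rw [fderiv_inner_apply ℝ (differentiableAt_const c)
      ((differentiableAt_of_contDiffOn_isOpen hW hF hy).sub_const _)] at e'
    simpa [fderiv_sub_const] using e'
  have h2 : ∀ X Z, inner ℝ c (fderiv ℝ (fderiv ℝ F) o Z X) = 0 := by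
    intro X Z
    have hFd := differentiableAt_of_contDiffOn_isOpen hW hF' ho
    have e : (fun z => inner ℝ c (fderiv ℝ F z X)) =ᶠ[nhds o] fun z => (0 : ℝ) :=
      Filter.eventually_of_mem (hW.mem_nhds ho) fun z hz => h1 z hz X
    have e' := congrArg (fun A => A Z) (e.fderiv_eq (𝕜 := ℝ))
    rw [fderiv_inner_apply ℝ (differentiableAt_const c)
      (hFd.clm_apply (differentiableAt_const X)), fderiv_clm_apply_const hFd] at e'
    simpa using e'
  obtain ⟨e, he⟩ := exists_ne (0 : E)
  obtain ⟨l, hl⟩ := Module.Projective.exists_dual_eq_one ℝ he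
  have h3 : ∀ (t : ℝ) (w : V), inner ℝ c w = 0 → inner ℝ w (t • c) = 0 := fun t w h => by
    rw [real_inner_smul_right, real_inner_comm, h, mul_zero]
  -- The rank-one form `l ⊗ c` is admissible because `c` is orthogonal to all first and second
  -- derivatives of `F` at `o`: both sides of the symmetry condition vanish.
  have := hnd (l.smulRight c) (fun X Z => h3 _ _ (h1 o ho X))
    (fun Z' X Z => (h3 _ _ (h2 X Z')).trans (h3 _ _ (h2 X Z)).symm)
  simpa [hl] using LinearMap.congr_fun this e

end Nondegenerate

/-- Two families with `⟨b a, g β⟩ + ⟨f a, c β⟩ = 0`, where the `f a` and the `g β` are total, are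
related by a linear map. -/
theorem exists_linearMap_of_inner_add_inner_eq_zero {α β V W : Type*}
    [NormedAddCommGroup V] [InnerProductSpace ℝ V] [FiniteDimensional ℝ V]
    [NormedAddCommGroup W] [InnerProductSpace ℝ W]
    (f : α → V) (b : α → W) (g : β → W) (c : β → V)
    (hf : ∀ v, (∀ a, inner ℝ v (f a) = 0) → v = 0)
    (hg : ∀ w, (∀ a, inner ℝ w (g a) = 0) → w = 0)
    (h : ∀ a a', inner ℝ (b a) (g a') + inner ℝ (f a) (c a') = 0) :
    ∃ D : V →ₗ[ℝ] W, ∀ a, b a = D (f a) := by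
  have hsurj : Function.Surjective (Finsupp.linearCombination ℝ f) := by
    rw [← LinearMap.range_eq_top, Finsupp.range_linearCombination,
      ← Submodule.orthogonal_eq_bot_iff, eq_bot_iff]
    intro v hv
    refine hf v fun a => ?_
    rw [real_inner_comm]
    exact hv _ (Submodule.subset_span ⟨a, rfl⟩)
  -- Every linear relation among the `f a` holds among the `b a`, since the corresponding
  -- combination of the `b a` is orthogonal to all `g a'`. Hence `f a ↦ b a` extends linearly to the
  -- span.
  have hker : ∀ x, Finsupp.linearCombination ℝ f x = 0 → Finsupp.linearCombination ℝ b x = 0 := by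
    intro x hx
    refine hg _ fun a' => ?_
    have e : ∀ x : α →₀ ℝ, inner ℝ (Finsupp.linearCombination ℝ b x) (g a') =
        - inner ℝ (Finsupp.linearCombination ℝ f x) (c a') := by
      intro x
      induction x using Finsupp.induction_linear with
      | zero => simp
      | add x y hx hy => simp only [map_add, inner_add_left, hx, hy]; ring
      | single a t =>
        simp only [Finsupp.linearCombination_single, real_inner_smul_left]
        linear_combination t * h a a'
    rw [e, hx]; simp
  obtain ⟨r, hr⟩ := (Finsupp.linearCombination ℝ f).exists_rightInverse_of_surjective
    (LinearMap.range_eq_top.2 hsurj)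
  refine ⟨Finsupp.linearCombination ℝ b ∘ₗ r, fun a => ?_⟩
  have := hker (Finsupp.single a 1 - r (f a)) (by
    have := LinearMap.congr_fun hr (f a)
    simp only [LinearMap.comp_apply, LinearMap.id_apply] at this
    simp [this])
  simpa [sub_eq_zero] using this

/-! ### Additivity of functions on boxes; product bendings in coordinates. -/

section Box

theorem update_mem_box {ι : Type*} [DecidableEq ι] {E : ι → Type*}
    {W : ∀ i, Set (E i)} {y : ∀ i, E i} (hy : y ∈ Set.univ.pi W) {i : ι} {z : E i} (hz : z ∈ W i) :
    Function.update y i z ∈ Set.univ.pi W :=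
  (Set.update_mem_pi_iff_of_mem hy).2 fun _ => hz

/-- The coordinates other than `a` are reset to the base point one at a time, by induction on the
set of coordinates already reset. -/
theorem eq_update_of_forall_eq_update {ι : Type*} [Fintype ι] [DecidableEq ι] {X : ι → Type*}
    {β : Type*} {W : ∀ i, Set (X i)} {o : ∀ i, X i} (ho : ∀ i, o i ∈ W i) (a : ι)
    {g : (∀ i, X i) → β}
    (hg : ∀ x, (∀ i, x i ∈ W i) → ∀ j, j ≠ a → g x = g (Function.update x j (o j)))
    {x : ∀ i, X i} (hx : ∀ i, x i ∈ W i) : g x = g (Function.update o a (x a)) := by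
  have key : ∀ s : Finset ι, a ∉ s → g x = g (s.piecewise o x) := by
    intro s
    induction s using Finset.induction_on with
    | empty => simp
    | insert j s hj ih =>
      intro ha
      rw [Finset.mem_insert, not_or] at ha
      rw [ih ha.2, Finset.piecewise_insert]
      refine hg _ (fun i => ?_) j (Ne.symm ha.1)
      by_cases h : i ∈ s
      · simpa [h] using ho i
      · simpa [h] using hx i
  rw [key (Finset.univ.erase a) (by simp)]
  congr 1
  ext i
  by_cases h : i = a
  · subst h; simp
  · simp [h]

/-- A function on a box all of whose mixed second differences vanish is additive. -/
theorem eq_add_sum_of_second_difference_eq_zero {ι : Type*} [Fintype ι] [DecidableEq ι]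
    {X : ι → Type*} {β : Type*} [AddCommGroup β] {W : ∀ i, Set (X i)} {o : ∀ i, X i}
    (ho : ∀ i, o i ∈ W i) {h : (∀ i, X i) → β}
    (hh : ∀ x, (∀ i, x i ∈ W i) → ∀ a j, j ≠ a → h x - h (Function.update x a (o a)) =
      h (Function.update x j (o j)) -
        h (Function.update (Function.update x j (o j)) a (o a)))
    {x : ∀ i, X i} (hx : ∀ i, x i ∈ W i) :
    h x = h o + ∑ i, (h (Function.update o i (x i)) - h o) := by
  -- Vanishing mixed differences make the increment in the variable `a` independent of all other
  -- variables, so it can be computed on the axis through `o`. The increments then telescope.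
  have single : ∀ x, (∀ i, x i ∈ W i) → ∀ a, h x - h (Function.update x a (o a)) =
      h (Function.update o a (x a)) - h o := by
    intro x hx a
    have := eq_update_of_forall_eq_update ho a
      (g := fun x => h x - h (Function.update x a (o a))) (fun x hx j hj => hh x hx a j hj) hx
    simpa using this
  have key : ∀ s : Finset ι, h (s.piecewise x o) =
      h o + ∑ i ∈ s, (h (Function.update o i (x i)) - h o) := by
    intro s
    induction s using Finset.induction_on with
    | empty => simp
    | insert j s hj ih =>
      have hm : ∀ i, (insert j s).piecewise x o i ∈ W i := fun i => by
        by_cases h : i ∈ insert j s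
        · rw [Finset.piecewise_eq_of_mem _ _ _ h]; exact hx i
        · rw [Finset.piecewise_eq_of_notMem _ _ _ h]; exact ho i
      have e := single _ hm j
      have e2 : Function.update ((insert j s).piecewise x o) j (o j) = s.piecewise x o := by
        rw [Finset.piecewise_insert, Function.update_idem]
        refine (Function.update_eq_self_iff).2 ?_
        simp [hj]
      rw [e2, ih] at e
      rw [Finset.sum_insert hj]
      simp only [Finset.mem_insert_self, Finset.piecewise_eq_of_mem] at e
      rw [sub_eq_iff_eq_add.1 e]
      abel
  simpa using key Finset.univ

variable {ι : Type*} [Fintype ι] [DecidableEq ι]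
  {E : ι → Type*} [∀ i, NormedAddCommGroup (E i)] [∀ i, NormedSpace ℝ (E i)]
  {V : ι → Type*} [∀ i, NormedAddCommGroup (V i)] [∀ i, InnerProductSpace ℝ (V i)]

/-- `G = (G i)` is an infinitesimal bending of the product of the maps `F i`, over the product of
the convex open sets `W i` on which the `F i` are nondegenerate. -/
structure IsBoxBending (F : ∀ i, E i → V i) (G : ∀ i, (∀ j, E j) → V i)
    (W : ∀ i, Set (E i)) : Prop where
  isOpen : ∀ i, IsOpen (W i)
  convex : ∀ i, Convex ℝ (W i)
  smooth : ∀ i, ContDiffOn ℝ ∞ (F i) (W i)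
  smooth_bending : ∀ i, ContDiffOn ℝ ∞ (G i) (Set.univ.pi W)
  nondegenerate : ∀ i, ∀ y ∈ W i, NondegenerateAt (F i) y
  diag : ∀ y ∈ Set.univ.pi W, ∀ i X Z,
    inner ℝ (fderiv ℝ (G i) y (Pi.single i X)) (fderiv ℝ (F i) (y i) Z) +
      inner ℝ (fderiv ℝ (F i) (y i) X) (fderiv ℝ (G i) y (Pi.single i Z)) = 0
  offDiag : ∀ y ∈ Set.univ.pi W, ∀ i j, i ≠ j → ∀ X Y,
    inner ℝ (fderiv ℝ (G j) y (Pi.single i X)) (fderiv ℝ (F j) (y j) Y) +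
      inner ℝ (fderiv ℝ (F i) (y i) X) (fderiv ℝ (G i) y (Pi.single j Y)) = 0

namespace IsBoxBending

variable {F : ∀ i, E i → V i} {G : ∀ i, (∀ j, E j) → V i} {W : ∀ i, Set (E i)}

theorem isOpen_box (h : IsBoxBending F G W) : IsOpen (Set.univ.pi W) :=
  isOpen_set_pi Set.finite_univ fun i _ => h.isOpen i

theorem hasFDerivAt_comp_update {V' : Type*} [NormedAddCommGroup V'] [NormedSpace ℝ V']
    {g : (∀ j, E j) → V'} {y : ∀ i, E i} {i : ι} {z : E i}
    (hg : DifferentiableAt ℝ g (Function.update y i z)) :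
    HasFDerivAt (fun z => g (Function.update y i z))
      (fderiv ℝ g (Function.update y i z) ∘L ContinuousLinearMap.single ℝ E i) z := by
  have := hg.hasFDerivAt.comp z (hasFDerivAt_update (𝕜 := ℝ) y z)
  have e : ContinuousLinearMap.single ℝ E i =
      .pi (Pi.single i (ContinuousLinearMap.id ℝ (E i))) := by
    ext x j
    by_cases hj : j = i
    · subst hj; simp
    · simp [hj]
  rw [e]
  exact this

theorem fderiv_comp_update {V' : Type*} [NormedAddCommGroup V'] [NormedSpace ℝ V']
    {g : (∀ j, E j) → V'} {y : ∀ i, E i} {i : ι} {z : E i}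
    (hg : DifferentiableAt ℝ g (Function.update y i z)) (X : E i) :
    fderiv ℝ (fun z => g (Function.update y i z)) z X =
      fderiv ℝ g (Function.update y i z) (Pi.single i X) := by
  rw [(hasFDerivAt_comp_update hg).fderiv]; simp

theorem contDiffOn_comp_update {V' : Type*} [NormedAddCommGroup V'] [NormedSpace ℝ V']
    {g : (∀ j, E j) → V'} (hg : ContDiffOn ℝ ∞ g (Set.univ.pi W)) {y : ∀ i, E i}
    (hy : y ∈ Set.univ.pi W) (i : ι) :
    ContDiffOn ℝ ∞ (fun z => g (Function.update y i z)) (W i) :=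
  hg.comp (contDiff_update ∞ y i).contDiffOn fun _ hz => update_mem_box hy hz

theorem contDiffOn_fderiv_apply (h : IsBoxBending F G W) (i : ι) (Y : ∀ j, E j) :
    ContDiffOn ℝ ∞ (fun y => fderiv ℝ (G i) y Y) (Set.univ.pi W) :=
  (contDiffOn_fderiv_of_isOpen h.isOpen_box (h.smooth_bending i)).clm_apply contDiffOn_const

theorem eq_of_fderiv_eq_zero {E' V' : Type*} [NormedAddCommGroup E'] [NormedSpace ℝ E']
    [NormedAddCommGroup V'] [NormedSpace ℝ V'] {W : Set E'} (hW : IsOpen W) (hc : Convex ℝ W)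
    {g : E' → V'} (hg : ∀ z ∈ W, HasFDerivAt g (0 : E' →L[ℝ] V') z) {a b : E'}
    (ha : a ∈ W) (hb : b ∈ W) : g a = g b :=
  hW.is_const_of_fderiv_eq_zero (𝕜 := ℝ) hc.isPreconnected
    (fun z hz => (hg z hz).differentiableAt.differentiableWithinAt)
    (fun z hz => (hg z hz).fderiv) ha hb

/-- The derivative of the `i`-th component along another factor is independent of the `i`-th
variable. -/
theorem fderiv_single_update (h : IsBoxBending F G W) {i j : ι} (hij : i ≠ j)
    {y : ∀ i, E i} (hy : y ∈ Set.univ.pi W) {a : E i} (ha : a ∈ W i) (Y : E j) :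
    fderiv ℝ (G i) (Function.update y i a) (Pi.single j Y) =
      fderiv ℝ (G i) y (Pi.single j Y) := by
  have hd : ∀ (k : ι), ∀ z ∈ Set.univ.pi W, DifferentiableAt ℝ (G k) z := fun k z hz =>
    differentiableAt_of_contDiffOn_isOpen h.isOpen_box (h.smooth_bending k) hz
  have hdd : ∀ (k : ι), ∀ z ∈ Set.univ.pi W, DifferentiableAt ℝ (fderiv ℝ (G k)) z :=
    fun k z hz => differentiableAt_of_contDiffOn_isOpen h.isOpen_box
      (contDiffOn_fderiv_of_isOpen h.isOpen_box (h.smooth_bending k)) hz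
  have hSc := contDiffOn_comp_update (h.contDiffOn_fderiv_apply i (Pi.single j Y)) hy i
  -- This is the potential `θ = -⟨G j, ∂_Y F j⟩`. The second entry does not depend on the `i`-th
  -- variable, so the off-diagonal equation identifies the gradient of `θ` with the tangent
  -- component of `∂_Y (G i)`.
  have hθc : ContDiffOn ℝ ∞ (fun z => -inner ℝ (G j (Function.update y i z))
      (fderiv ℝ (F j) (y j) Y)) (W i) :=
    ((contDiffOn_comp_update (h.smooth_bending j) hy i).inner ℝ contDiffOn_const).neg
  have hS' : ∀ z ∈ W i, ∀ X, fderiv ℝ (fun z => fderiv ℝ (G i) (Function.update y i z)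
      (Pi.single j Y)) z X = fderiv ℝ (fderiv ℝ (G i)) (Function.update y i z) (Pi.single j Y)
        (Pi.single i X) := by
    intro z hz X
    have hm := update_mem_box hy hz
    rw [fderiv_comp_update (g := fun y => fderiv ℝ (G i) y (Pi.single j Y))
      ((hdd i _ hm).clm_apply (differentiableAt_const _)), fderiv_clm_apply_const (hdd i _ hm),
      fderiv_fderiv_symm h.isOpen_box (h.smooth_bending i) hm]
  have zero : ∀ z ∈ W i, fderiv ℝ (fun z => fderiv ℝ (G i) (Function.update y i z)
      (Pi.single j Y)) z = 0 := by
    intro z hz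
    refine fderiv_eq_zero_of_bending_of_gradient (h.isOpen i) (h.smooth i) hSc hθc
      (h.nondegenerate i) ?_ ?_ hz
    -- The diagonal equation is differentiated along `Y` in the `j`-th variable, on which `F i` does
    -- not depend.
    · intro z hz X Z
      rw [hS' z hz, hS' z hz]
      have hm := update_mem_box hy hz
      set u := Function.update y i z with hu
      have huj : u j = y j := by simp [hu, hij.symm]
      have hmj : ∀ w ∈ W j, Function.update u j w ∈ Set.univ.pi W :=
        fun w hw => update_mem_box hm hw
      have hyj : u j ∈ W j := hm j trivial
      have e : (fun w => inner ℝ (fderiv ℝ (G i) (Function.update u j w) (Pi.single i X))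
          (fderiv ℝ (F i) z Z) + inner ℝ (fderiv ℝ (F i) z X)
            (fderiv ℝ (G i) (Function.update u j w) (Pi.single i Z))) =ᶠ[nhds (u j)]
          fun _ => (0 : ℝ) := by
        refine Filter.eventually_of_mem ((h.isOpen j).mem_nhds hyj) fun w hw => ?_
        have := h.diag _ (hmj w hw) i X Z
        simpa [hij, hu] using this
      have e' := congrArg (fun A => A Y) (e.fderiv_eq (𝕜 := ℝ))
      have hself : Function.update u j (u j) = u := Function.update_eq_self j u
      have dG : ∀ X, DifferentiableAt ℝ (fun y => fderiv ℝ (G i) y (Pi.single i X))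
          (Function.update u j (u j)) := fun X => by
        rw [hself]
        exact (hdd i _ hm).clm_apply (differentiableAt_const _)
      have dU : ∀ X, DifferentiableAt ℝ (fun w => fderiv ℝ (G i) (Function.update u j w)
          (Pi.single i X)) (u j) := fun X => (hasFDerivAt_comp_update (dG X)).differentiableAt
      have dU' : ∀ X, fderiv ℝ (fun w => fderiv ℝ (G i) (Function.update u j w)
          (Pi.single i X)) (u j) Y =
            fderiv ℝ (fderiv ℝ (G i)) u (Pi.single j Y) (Pi.single i X) := fun X => by
        rw [fderiv_comp_update (g := fun y => fderiv ℝ (G i) y (Pi.single i X)) (dG X), hself,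
          fderiv_clm_apply_const (hdd i _ hm)]
      rw [fderiv_fun_add ((dU X).inner ℝ (differentiableAt_const _))
        ((differentiableAt_const _).inner ℝ (dU Z)), add_apply,
        fderiv_inner_apply ℝ (dU X) (differentiableAt_const _),
        fderiv_inner_apply ℝ (differentiableAt_const _) (dU Z), dU', dU'] at e'
      simpa using e'
    · intro z hz X
      have hm := update_mem_box hy hz
      have dG := (hasFDerivAt_comp_update (hd j _ hm)).differentiableAt
      have e := h.offDiag _ hm i j hij X Y
      rw [fderiv_fun_neg, neg_apply,
        fderiv_inner_apply ℝ dG (differentiableAt_const _), fderiv_comp_update (hd j _ hm)]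
      simp only [Function.update_self, Function.update_of_ne hij.symm] at e
      simp only [fderiv_fun_const, Pi.zero_apply, zero_apply, inner_zero_right,
        zero_add]
      linarith
  have := eq_of_fderiv_eq_zero (h.isOpen i) (h.convex i) (fun z hz => by
    have := (differentiableAt_of_contDiffOn_isOpen (h.isOpen i) hSc hz).hasFDerivAt
    rwa [zero z hz] at this) ha (hy i trivial)
  simpa using this

end IsBoxBending

end Box

/-! ### Integration of the bending equations over a box. -/

namespace IsBoxBending

open Function (update)

variable {ι : Type*} [Fintype ι] [DecidableEq ι]
  {E : ι → Type*} [∀ i, NormedAddCommGroup (E i)] [∀ i, NormedSpace ℝ (E i)]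
  {V : ι → Type*} [∀ i, NormedAddCommGroup (V i)] [∀ i, InnerProductSpace ℝ (V i)]
  {F : ∀ i, E i → V i} {G : ∀ i, (∀ j, E j) → V i} {W : ∀ i, Set (E i)}

theorem differentiableAt_bending (h : IsBoxBending F G W) (i : ι) {y : ∀ i, E i}
    (hy : y ∈ Set.univ.pi W) : DifferentiableAt ℝ (G i) y :=
  differentiableAt_of_contDiffOn_isOpen h.isOpen_box (h.smooth_bending i) hy

/-- Obtained by integrating `fderiv_single_update` along the `j`-th factor: the mixed second
difference of `G i` in its own variable and any other one vanishes. -/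
theorem sub_update_eq_update_sub_update (h : IsBoxBending F G W) {i j : ι} (hij : i ≠ j)
    {y : ∀ i, E i} (hy : y ∈ Set.univ.pi W) {a : E i} (ha : a ∈ W i) {b : E j} (hb : b ∈ W j) :
    G i y - G i (update y i a) = G i (update y j b) - G i (update (update y j b) i a) := by
  have := eq_of_fderiv_eq_zero (h.isOpen j) (h.convex j)
    (g := fun z => G i (update y j z) - G i (update (update y i a) j z)) (fun z hz => by
      have hm := update_mem_box hy hz
      have hm' := update_mem_box (update_mem_box hy ha) hz
      have := (hasFDerivAt_comp_update (h.differentiableAt_bending i hm)).sub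
        (hasFDerivAt_comp_update (h.differentiableAt_bending i hm'))
      refine this.congr_fderiv ?_
      ext Y
      have e := h.fderiv_single_update hij hm ha Y
      rw [Function.update_comm hij.symm] at e
      simpa [sub_eq_zero] using e.symm) (hy j trivial) hb
  rw [Function.update_comm hij.symm]
  simpa [Function.update_of_ne hij.symm, Function.update_comm hij a (y j)] using this

/-- The off-diagonal bending equations in integrated form. -/
theorem inner_sub_update_add_inner_sub_update (h : IsBoxBending F G W) {i j : ι} (hij : i ≠ j)
    {o y : ∀ i, E i} (ho : o ∈ Set.univ.pi W) (hy : y ∈ Set.univ.pi W) :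
    inner ℝ (G j y - G j (update y i (o i))) (F j (y j) - F j (o j)) +
      inner ℝ (F i (y i) - F i (o i)) (G i y - G i (update y j (o j))) = 0 := by
  have hoi : o i ∈ W i := ho i trivial
  have hoj : o j ∈ W j := ho j trivial
  have hFd : ∀ k, ∀ z ∈ W k, HasFDerivAt (F k) (fderiv ℝ (F k) z) z := fun k z hz =>
    (differentiableAt_of_contDiffOn_isOpen (h.isOpen k) (h.smooth k) hz).hasFDerivAt
  -- Integration in the `j`-th variable only. The derivative of `G j` along `X` does not depend on
  -- that variable, so it comes out as a constant factor against the chord of `F j`.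
  have partly : ∀ y ∈ Set.univ.pi W, ∀ X,
      inner ℝ (fderiv ℝ (G j) y (Pi.single i X)) (F j (y j) - F j (o j)) +
        inner ℝ (fderiv ℝ (F i) (y i) X) (G i y - G i (update y j (o j))) = 0 := by
    intro y hy X
    have := eq_of_fderiv_eq_zero (h.isOpen j) (h.convex j)
      (g := fun z => inner ℝ (fderiv ℝ (G j) y (Pi.single i X)) (F j z) +
        inner ℝ (fderiv ℝ (F i) (y i) X) (G i (update y j z))) (fun z hz => by
        have hm := update_mem_box hy hz
        have := ((hasFDerivAt_const (fderiv ℝ (G j) y (Pi.single i X)) z).inner ℝ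
          (hFd j z hz)).add ((hasFDerivAt_const (fderiv ℝ (F i) (y i) X) z).inner ℝ
            (hasFDerivAt_comp_update (h.differentiableAt_bending i hm)))
        refine this.congr_fderiv ?_
        ext Y
        have e := h.offDiag _ hm i j hij X Y
        rw [h.fderiv_single_update hij.symm hy hz, Function.update_self,
          Function.update_of_ne hij] at e
        simpa using e) (hy j trivial) hoj
    simp only [Function.update_eq_self] at this
    simp only [inner_sub_right]
    linarith
  -- Integration in the `i`-th variable; now the increment of `G i` in the `j`-th variable is the
  -- constant factor.
  have := eq_of_fderiv_eq_zero (h.isOpen i) (h.convex i)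
    (g := fun z => inner ℝ (G j (update y i z)) (F j (y j) - F j (o j)) +
      inner ℝ (F i z) (G i y - G i (update y j (o j)))) (fun z hz => by
      have hm := update_mem_box hy hz
      have := ((hasFDerivAt_comp_update (h.differentiableAt_bending j hm)).inner ℝ
        (hasFDerivAt_const (F j (y j) - F j (o j)) z)).add ((hFd i z hz).inner ℝ
          (hasFDerivAt_const (G i y - G i (update y j (o j))) z))
      refine this.congr_fderiv ?_
      ext X
      have e := partly _ hm X
      have e2 := h.sub_update_eq_update_sub_update hij hy hz hoj
      rw [Function.update_comm hij.symm] at e2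
      rw [Function.update_self, Function.update_of_ne hij.symm,
        ← sub_eq_sub_iff_sub_eq_sub.1 e2] at e
      simpa using e) (hy i trivial) hoi
  simp only [Function.update_eq_self] at this
  simp only [inner_sub_left] at this ⊢
  linarith

/-- The integrated equation at the point that differs from `o` only in `i` and `j`, with both
increments moved to the axes through `o`. The points `z` and `w` now vary independently, as needed
for the linear map between chords. -/
theorem inner_update_sub_add_inner_update_sub (h : IsBoxBending F G W) {i j : ι} (hij : i ≠ j)
    {o : ∀ i, E i} (ho : o ∈ Set.univ.pi W) {z : E i} (hz : z ∈ W i) {w : E j} (hw : w ∈ W j) :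
    inner ℝ (G j (update o i z) - G j o) (F j w - F j (o j)) +
      inner ℝ (F i z - F i (o i)) (G i (update o j w) - G i o) = 0 := by
  have m := update_mem_box (update_mem_box ho hz) hw
  have e := h.inner_sub_update_add_inner_sub_update hij ho m
  have e1 := h.sub_update_eq_update_sub_update hij.symm m (ho j trivial) (ho i trivial)
  have e2 := h.sub_update_eq_update_sub_update hij m (ho i trivial) (ho j trivial)
  rw [sub_eq_sub_iff_sub_eq_sub] at e1 e2
  rw [e1, e2] at e
  have s : update (update o j w) i (o i) = update o j w :=
    Function.update_eq_self_iff.2 (by simp [hij])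
  simpa [Function.update_comm hij, Function.update_of_ne hij, Function.update_of_ne hij.symm, s]
    using e

variable [∀ i, Nontrivial (E i)]

/-- Pair the second difference of `G a` in `b, c` with the chord of `F a`. The result is symmetric
in `b, c` and skew in `a, b`, so alternating the two exchanges shows that it equals its own
negative. The second difference itself does not depend on the variable `a`, so it is orthogonal to
every chord of `F a` and vanishes. -/
theorem second_difference_eq_zero_of_ne (h : IsBoxBending F G W) {i j k : ι} (hij : i ≠ j)
    (hjk : j ≠ k) (hik : i ≠ k) {o y : ∀ i, E i} (ho : o ∈ Set.univ.pi W)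
    (hy : y ∈ Set.univ.pi W) :
    G j y - G j (update y i (o i)) =
      G j (update y k (o k)) - G j (update (update y k (o k)) i (o i)) := by
  -- `Q a b` is skew in `a, b`, and its difference in the third variable is symmetric.
  have hQ : ∀ y ∈ Set.univ.pi W, ∀ a b, a ≠ b →
      inner ℝ (G a y - G a (update y b (o b))) (F a (y a) - F a (o a)) =
        - inner ℝ (G b y - G b (update y a (o a))) (F b (y b) - F b (o b)) := by
    intro y hy a b hab
    have := h.inner_sub_update_add_inner_sub_update hab ho hy
    rw [real_inner_comm (F a (y a) - F a (o a))] at *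
    linarith
  have hR : ∀ y ∈ Set.univ.pi W,
      inner ℝ (G j y - G j (update y i (o i)) - (G j (update y k (o k)) -
        G j (update (update y k (o k)) i (o i)))) (F j (y j) - F j (o j)) = 0 := by
    intro y hy
    have mi := update_mem_box hy (ho i trivial)
    have mj := update_mem_box hy (ho j trivial)
    have mk := update_mem_box hy (ho k trivial)
    have a1 := hQ y hy j i hij.symm
    have a2 := hQ _ mk j i hij.symm
    have b1 := hQ y hy i k hik
    have b2 := hQ _ mj i k hik
    have c1 := hQ y hy k j hjk.symm
    have c2 := hQ _ mi k j hjk.symm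
    simp only [Function.update_of_ne hij, Function.update_of_ne hij.symm,
      Function.update_of_ne hik, Function.update_of_ne hik.symm, Function.update_of_ne hjk,
      Function.update_of_ne hjk.symm, Function.update_comm hik.symm (o k) (o i),
      Function.update_comm hij.symm (o j) (o i),
      Function.update_comm hjk.symm (o k) (o j), inner_sub_left] at a1 a2 b1 b2 c1 c2 ⊢
    linarith
  refine sub_eq_zero.1 (eq_zero_of_orthogonal_chords (h.isOpen j) (h.smooth j) (ho j trivial)
    (h.nondegenerate j _ (ho j trivial)) fun z hz => ?_)
  have e1 := h.sub_update_eq_update_sub_update hij.symm hy hz (ho i trivial)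
  have e2 := h.sub_update_eq_update_sub_update hij.symm
    (update_mem_box hy (ho k trivial)) hz (ho i trivial)
  have e := hR _ (update_mem_box hy hz)
  rw [Function.update_self] at e
  rw [← e]
  congr 1
  rw [Function.update_comm hij.symm z (o i) y, Function.update_comm hjk z (o k) y,
    Function.update_comm hij.symm z (o i) (update y k (o k)), sub_eq_sub_iff_sub_eq_sub.1 e1,
    sub_eq_sub_iff_sub_eq_sub.1 e2]

theorem eq_add_sum (h : IsBoxBending F G W) {o y : ∀ i, E i} (ho : o ∈ Set.univ.pi W)
    (hy : y ∈ Set.univ.pi W) (i : ι) :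
    G i y = G i o + ∑ j, (G i (update o j (y j)) - G i o) := by
  refine eq_add_sum_of_second_difference_eq_zero (W := W) (fun j => ho j trivial)
    (fun x hx a j hj => ?_) (fun j => hy j trivial)
  have hx' : x ∈ Set.univ.pi W := fun j _ => hx j
  -- If one of the two variables is the `i`-th, the difference vanishes by the gradient argument;
  -- otherwise three distinct indices are involved.
  by_cases hai : i = a
  · subst hai
    exact h.sub_update_eq_update_sub_update hj.symm hx' (ho i trivial) (ho j trivial)
  by_cases hji : i = j
  · subst hji
    have := h.sub_update_eq_update_sub_update hj hx' (ho i trivial) (ho a trivial)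
    rw [Function.update_comm hj]
    exact sub_eq_sub_iff_sub_eq_sub.1 this
  · exact h.second_difference_eq_zero_of_ne (Ne.symm hai) hji hj.symm ho hx'

variable [∀ i, FiniteDimensional ℝ (V i)]

/-- The integrated off-diagonal equation pairs increments with chords, and the chords of each factor
are total by nondegeneracy. -/
theorem exists_linearMap_update_sub (h : IsBoxBending F G W) {i j : ι} (hij : i ≠ j)
    {o : ∀ i, E i} (ho : o ∈ Set.univ.pi W) :
    ∃ D : V j →ₗ[ℝ] V i, ∀ w ∈ W j, G i (update o j w) - G i o = D (F j w - F j (o j)) := by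
  have tot : ∀ k, ∀ v : V k, (∀ a : W k, inner ℝ v (F k a - F k (o k)) = 0) → v = 0 :=
    fun k v hv => eq_zero_of_orthogonal_chords (h.isOpen k) (h.smooth k) (ho k trivial)
      (h.nondegenerate k _ (ho k trivial)) fun y hy => hv ⟨y, hy⟩
  obtain ⟨D, hD⟩ := exists_linearMap_of_inner_add_inner_eq_zero
    (fun w : W j => F j w - F j (o j)) (fun w : W j => G i (update o j w) - G i o)
    (fun z : W i => F i z - F i (o i)) (fun z : W i => G j (update o i z) - G j o)
    (tot j) (tot i) fun w z =>
      h.inner_update_sub_add_inner_update_sub hij.symm ho w.2 z.2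
  exact ⟨D, fun w hw => hD ⟨w, hw⟩⟩

/-- A bending over a box is the sum of bendings of the factors and of a trivial bending. -/
theorem exists_skew (h : IsBoxBending F G W) {o : ∀ i, E i} (ho : o ∈ Set.univ.pi W) :
    ∃ D : PiLp 2 V →ₗ[ℝ] PiLp 2 V, (∀ a b, inner ℝ (D a) b = -inner ℝ a (D b)) ∧
      ∀ y ∈ Set.univ.pi W, ∀ i, G i y = G i (update o i (y i)) +
        D (WithLp.toLp 2 fun j => F j (y j) - F j (o j)) i := by
  have hex : ∀ i j, ∃ D : V j →ₗ[ℝ] V i, (i = j → D = 0) ∧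
      (i ≠ j → ∀ w ∈ W j, G i (update o j w) - G i o = D (F j w - F j (o j))) := by
    intro i j
    by_cases hij : i = j
    · exact ⟨0, fun _ => rfl, fun h' => absurd hij h'⟩
    · obtain ⟨D, hD⟩ := h.exists_linearMap_update_sub hij ho
      exact ⟨D, fun h' => absurd h' hij, fun _ => hD⟩
  choose D hD0 hD using hex
  -- The off-diagonal equation gives this for `u` and `v` chords; totality is used once in each
  -- factor to pass to all vectors. The diagonal blocks were chosen to be zero.
  have skew : ∀ i j u v, inner ℝ (D i j v) u = - inner ℝ v (D j i u) := by
    intro i j u v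
    by_cases hij : i = j
    · subst hij; simp [hD0 i i rfl]
    have tot : ∀ k, ∀ v : V k, (∀ a ∈ W k, inner ℝ v (F k a - F k (o k)) = 0) → v = 0 :=
      fun k v hv => eq_zero_of_orthogonal_chords (h.isOpen k) (h.smooth k) (ho k trivial)
        (h.nondegenerate k _ (ho k trivial)) hv
    have key : ∀ z ∈ W i, LinearMap.adjoint (D i j) (F i z - F i (o i)) +
        D j i (F i z - F i (o i)) = 0 := fun z hz => tot j _ fun w hw => by
      have := h.inner_update_sub_add_inner_update_sub hij ho hz hw
      rw [hD j i (Ne.symm hij) z hz, hD i j hij w hw] at this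
      rw [inner_add_left, LinearMap.adjoint_inner_left]
      linarith
    have key2 : D i j v + LinearMap.adjoint (D j i) v = 0 := tot i _ fun z hz => by
      have := congrArg (inner ℝ v) (key z hz)
      rw [inner_add_right, LinearMap.adjoint_inner_right, inner_zero_right] at this
      rw [inner_add_left, LinearMap.adjoint_inner_left, this]
    have := congrArg (fun x => inner ℝ x u) key2
    simp only [inner_add_left, LinearMap.adjoint_inner_left, inner_zero_left] at this
    linarith
  let A : PiLp 2 V →ₗ[ℝ] PiLp 2 V :=
    (WithLp.linearEquiv 2 ℝ (∀ i, V i)).symm.toLinearMap ∘ₗ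
      (LinearMap.pi fun i => ∑ j, D i j ∘ₗ LinearMap.proj j) ∘ₗ
        (WithLp.linearEquiv 2 ℝ (∀ i, V i)).toLinearMap
  have hA : ∀ v i, A v i = ∑ j, D i j (v j) := fun v i => by simp [A]
  refine ⟨A, fun a b => ?_, fun y hy i => ?_⟩
  · simp only [PiLp.inner_apply, hA, sum_inner, inner_sum, skew, Finset.sum_neg_distrib]
    rw [Finset.sum_comm]
  · rw [hA, h.eq_add_sum ho hy i, ← Finset.add_sum_erase _ _ (Finset.mem_univ i),
      ← Finset.add_sum_erase _ (fun j => D i j _) (Finset.mem_univ i), hD0 i i rfl]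
    have : ∑ j ∈ Finset.univ.erase i, (G i (update o j (y j)) - G i o) =
        ∑ j ∈ Finset.univ.erase i, D i j (F j (y j) - F j (o j)) :=
      Finset.sum_congr rfl fun j hj => hD i j (Finset.ne_of_mem_erase hj).symm _ (hy j trivial)
    rw [this]
    simp only [LinearMap.zero_apply, zero_add]
    abel

end IsBoxBending

/-! ### Coordinate independence of nondegeneracy. -/

section ChartChange

variable {E : Type*} [NormedAddCommGroup E] [NormedSpace ℝ E] [FiniteDimensional ℝ E]
  {V : Type*} [NormedAddCommGroup V] [InnerProductSpace ℝ V]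

/-- Nondegeneracy is independent of the coordinates. -/
theorem NondegenerateAt.of_comp {F F₁ : E → V} {ψ : E → E} {c : E}
    (h : NondegenerateAt F₁ c) (hinj : Function.Injective (fderiv ℝ F₁ c))
    (hF : ContDiffAt ℝ ∞ F (ψ c)) (hψ : ContDiffAt ℝ ∞ ψ c)
    (he : F₁ =ᶠ[nhds c] F ∘ ψ) : NondegenerateAt F (ψ c) := by
  have hne : (∞ : ℕ∞ω) ≠ 0 := by simp
  have hF' : DifferentiableAt ℝ (fderiv ℝ F) (ψ c) :=
    (hF.fderiv_right (m := ∞) (by simp)).differentiableAt hne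
  have hψ' : DifferentiableAt ℝ (fderiv ℝ ψ) c :=
    (hψ.fderiv_right (m := ∞) (by simp)).differentiableAt hne
  have hψd : DifferentiableAt ℝ ψ c := hψ.differentiableAt hne
  have hev : fderiv ℝ F₁ =ᶠ[nhds c] fun z => fderiv ℝ F (ψ z) ∘L fderiv ℝ ψ z := by
    have e1 : ∀ᶠ z in nhds c, ContDiffAt ℝ 1 ψ z :=
      (hψ.of_le (m := 1) (WithTop.coe_le_coe.2 le_top)).eventually (by simp)
    have e2 : ∀ᶠ z in nhds c, ContDiffAt ℝ 1 F (ψ z) := hψ.continuousAt.eventually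
      ((hF.of_le (m := 1) (WithTop.coe_le_coe.2 le_top)).eventually (by simp))
    filter_upwards [he.eventuallyEq_nhds, e1, e2] with z hz h1 h2
    rw [hz.fderiv_eq]
    exact fderiv_comp z (h2.differentiableAt (by simp)) (h1.differentiableAt (by simp))
  set A := fderiv ℝ ψ c with hA
  have first : ∀ X, fderiv ℝ F₁ c X = fderiv ℝ F (ψ c) (A X) := fun X => by
    rw [hev.eq_of_nhds]; rfl
  have second : ∀ Z X, fderiv ℝ (fderiv ℝ F₁) c Z X =
      fderiv ℝ F (ψ c) (fderiv ℝ (fderiv ℝ ψ) c Z X) +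
        fderiv ℝ (fderiv ℝ F) (ψ c) (A Z) (A X) := by
    intro Z X
    have hFψ : HasFDerivAt (fun z => fderiv ℝ F (ψ z)) (fderiv ℝ (fderiv ℝ F) (ψ c) ∘L A) c :=
      hF'.hasFDerivAt.comp c hψd.hasFDerivAt
    rw [hev.fderiv_eq, (hFψ.clm_comp hψ'.hasFDerivAt).fderiv]
    simp [hA]
  have hAinj : Function.Injective A := fun X Y hXY => hinj (by rw [first, first, hXY])
  have hAsurj : Function.Surjective A := LinearMap.injective_iff_surjective.1 hAinj
  intro B hB1 hB2
  -- The second derivative of `ψ` contributes only a tangent vector of `F`, which the normal-valued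
  -- form `B` does not see.
  have := h (B ∘ₗ (A : E →ₗ[ℝ] E)) (fun X Z => by rw [first]; exact hB1 _ _) (fun Z' X Z => by
    rw [second, second, inner_add_left, inner_add_left]
    simp only [LinearMap.comp_apply, ContinuousLinearMap.coe_coe]
    rw [hB1, hB1, hB2])
  ext X
  obtain ⟨Y, rfl⟩ := hAsurj X
  exact LinearMap.congr_fun this Y

end ChartChange

/-! ### Derivatives of extrinsic products. -/

section ProductMap

variable {ι : Type*} [Fintype ι]
  {E : ι → Type*} [∀ i, NormedAddCommGroup (E i)] [∀ i, NormedSpace ℝ (E i)]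
  {V : ι → Type*} [∀ i, NormedAddCommGroup (V i)] [∀ i, InnerProductSpace ℝ (V i)]
  {F : ∀ i, E i → V i}

theorem fderiv_piLp_apply {E' : Type*} [NormedAddCommGroup E'] [NormedSpace ℝ E']
    {P : E' → PiLp 2 V} {y : E'} (hP : DifferentiableAt ℝ P y) (X : E') (i : ι) :
    fderiv ℝ P y X i = fderiv ℝ (fun z => P z i) y X := by
  have := ((PiLp.proj 2 V i : PiLp 2 V →L[ℝ] V i).hasFDerivAt.comp y hP.hasFDerivAt).fderiv
  change _ = fderiv ℝ ((PiLp.proj 2 V i : PiLp 2 V →L[ℝ] V i) ∘ P) y X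
  rw [this]; rfl

theorem contDiffAt_extrinsicProduct {y : ∀ i, E i} (hF : ∀ i, ContDiffAt ℝ ∞ (F i) (y i)) :
    ContDiffAt ℝ ∞ (extrinsicProduct F) y :=
  (contDiffAt_piLp 2).2 fun i => (hF i).comp y (contDiffAt_pi.1 contDiffAt_id i)

theorem fderiv_comp_eval {V' : Type*} [NormedAddCommGroup V'] [NormedSpace ℝ V'] {i : ι}
    {g : E i → V'} {y : ∀ i, E i} (hg : DifferentiableAt ℝ g (y i)) (X : ∀ i, E i) :
    fderiv ℝ (fun z : ∀ i, E i => g (z i)) y X = fderiv ℝ g (y i) (X i) := by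
  have := (hg.hasFDerivAt.comp y (hasFDerivAt_apply (𝕜 := ℝ) i y)).fderiv
  change fderiv ℝ (g ∘ fun z : ∀ i, E i => z i) y X = _
  rw [this]; rfl

theorem fderiv_extrinsicProduct_apply {y : ∀ i, E i} (hF : ∀ i, ContDiffAt ℝ ∞ (F i) (y i))
    (X : ∀ i, E i) (i : ι) :
    fderiv ℝ (extrinsicProduct F) y X i = fderiv ℝ (F i) (y i) (X i) := by
  rw [fderiv_piLp_apply ((contDiffAt_extrinsicProduct hF).differentiableAt (by simp))]
  exact fderiv_comp_eval ((hF i).differentiableAt (by simp)) X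

theorem fderiv_fderiv_extrinsicProduct_apply {y : ∀ i, E i} {W : ∀ i, Set (E i)}
    (hW : ∀ i, IsOpen (W i)) (hy : ∀ i, y i ∈ W i) (hF : ∀ i, ContDiffOn ℝ ∞ (F i) (W i))
    (Y X : ∀ i, E i) (i : ι) :
    fderiv ℝ (fderiv ℝ (extrinsicProduct F)) y Y X i =
      fderiv ℝ (fderiv ℝ (F i)) (y i) (Y i) (X i) := by
  have hF' : ∀ z : ∀ i, E i, z ∈ Set.univ.pi W → ∀ i, ContDiffAt ℝ ∞ (F i) (z i) :=
    fun z hz i => (hF i).contDiffAt ((hW i).mem_nhds (hz i trivial))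
  have hym : y ∈ Set.univ.pi W := fun i _ => hy i
  have hP : DifferentiableAt ℝ (fderiv ℝ (extrinsicProduct F)) y :=
    ((contDiffAt_extrinsicProduct (hF' y hym)).fderiv_right (m := ∞) (by simp)).differentiableAt
      (by simp)
  have hFi : DifferentiableAt ℝ (fderiv ℝ (F i)) (y i) :=
    ((hF' y hym i).fderiv_right (m := ∞) (by simp)).differentiableAt (by simp)
  rw [← fderiv_clm_apply_const hP, ← fderiv_clm_apply_const hFi,
    fderiv_piLp_apply (hP.clm_apply (differentiableAt_const X)),
    ← fderiv_comp_eval (g := fun z => fderiv ℝ (F i) z (X i))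
      (hFi.clm_apply (differentiableAt_const _))]
  have : (fun z => fderiv ℝ (extrinsicProduct F) z X i) =ᶠ[nhds y]
      fun z => fderiv ℝ (F i) (z i) (X i) := by
    filter_upwards [(isOpen_set_pi Set.finite_univ fun i _ => hW i).mem_nhds hym] with z hz
    exact fderiv_extrinsicProduct_apply (hF' z hz) X i
  rw [this.fderiv_eq]

theorem inner_piLp_single [DecidableEq ι] (a : PiLp 2 V) (i : ι) (v : V i) :
    inner ℝ a (PiLp.single 2 i v) = inner ℝ (a i) v := by
  rw [PiLp.inner_apply, Finset.sum_eq_single i]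
  · simp
  · intro j _ hj; simp [hj]
  · simp

end ProductMap

/-! ### Smoothness of maps into and out of product manifolds. -/

section ProductManifold

variable {ι : Type*} [Fintype ι]
  {E : ι → Type*} [∀ i, NormedAddCommGroup (E i)] [∀ i, NormedSpace ℝ (E i)]
  {H : ι → Type*} [∀ i, TopologicalSpace (H i)] {I : ∀ i, ModelWithCorners ℝ (E i) (H i)}
  {M : ι → Type*} [∀ i, TopologicalSpace (M i)] [∀ i, ChartedSpace (H i) (M i)]
  {E' : Type*} [NormedAddCommGroup E'] [NormedSpace ℝ E']
  {H' : Type*} [TopologicalSpace H'] {J : ModelWithCorners ℝ E' H'}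
  {N : Type*} [TopologicalSpace N] [ChartedSpace H' N]

theorem contMDiffAt_pi_of_forall {m : ℕ∞ω} {h : N → ∀ i, M i} {y : N}
    (hh : ∀ i, ContMDiffAt J (I i) m (fun z => h z i) y) :
    ContMDiffAt J (ModelWithCorners.pi I) m h y := by
  rw [contMDiffAt_iff_target]
  refine ⟨continuousAt_pi.2 fun i => (hh i).continuousAt, contMDiffAt_pi_space.2 fun i => ?_⟩
  exact (contMDiffAt_iff_target.1 (hh i)).2

theorem contMDiff_eval {m : ℕ∞ω} (i : ι) :
    ContMDiff (ModelWithCorners.pi I) (I i) m (fun x : ∀ i, M i => x i) := by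
  intro x
  rw [contMDiffAt_iff_target]
  refine ⟨(continuous_apply i).continuousAt, ?_⟩
  exact contMDiffAt_pi_space.1 (contMDiffAt_extChartAt (I := ModelWithCorners.pi I) (x := x)) i

theorem contMDiff_extrinsicProduct {V : ι → Type*} [∀ i, NormedAddCommGroup (V i)]
    [∀ i, InnerProductSpace ℝ (V i)] {f : ∀ i, M i → V i}
    (hf : ∀ i, ContMDiff (I i) 𝓘(ℝ, V i) ∞ (f i)) :
    ContMDiff (ModelWithCorners.pi I) 𝓘(ℝ, PiLp 2 V) ∞ (extrinsicProduct f) := by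
  have h1 : ContMDiff (ModelWithCorners.pi I) 𝓘(ℝ, ∀ i, V i) ∞
      (fun x : ∀ i, M i => fun i => f i (x i)) :=
    contMDiff_pi_space.2 fun i => (hf i).comp (contMDiff_eval i)
  exact (PiLp.continuousLinearEquiv 2 ℝ V).symm.contDiff.contMDiff.comp h1

end ProductManifold

/-! ### Differential and Hessian in preferred charts. -/

section Charts

variable {E : Type*} [NormedAddCommGroup E] [NormedSpace ℝ E]
  {H : Type*} [TopologicalSpace H] {I : ModelWithCorners ℝ E H}
  {M : Type*} [TopologicalSpace M] [ChartedSpace H M]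
  {V : Type*} [NormedAddCommGroup V] [InnerProductSpace ℝ V]

theorem differential_eq_fderiv (hI : Set.range I = Set.univ) {f : M → V} {x : M}
    (hf : MDifferentiableAt I 𝓘(ℝ, V) f x) :
    differential I f x = fderiv ℝ (f ∘ (extChartAt I x).symm) (extChartAt I x x) := by
  rw [differential, hf.mfderiv, hI, fderivWithin_univ]
  rfl

theorem chartHessian_apply (hI : Set.range I = Set.univ) (f : M → V) (x : M)
    (X Y : TangentSpace I x) :
    chartHessian I f x X Y =
      fderiv ℝ (fderiv ℝ (f ∘ (extChartAt I x).symm)) (extChartAt I x x) X Y := by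
  rw [chartHessian, hI]
  simp only [fderivWithin_univ]
  rfl

variable [IsManifold I ∞ M]

theorem contDiffOn_comp_extChartAt_symm {f : M → V}
    (hf : ContMDiff I 𝓘(ℝ, V) ∞ f) (x : M) :
    ContDiffOn ℝ ∞ (f ∘ (extChartAt I x).symm) (extChartAt I x).target :=
  contMDiffOn_iff_contDiffOn.1 (hf.comp_contMDiffOn (contMDiffOn_extChartAt_symm x))

/-- Nondegeneracy in the preferred chart at a point yields nondegeneracy in every preferred chart
around that point. -/
theorem nondegenerateAt_of_extChartAt_self [FiniteDimensional ℝ E] [I.Boundaryless] {f : M → V}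
    (hf : ContMDiff I 𝓘(ℝ, V) ∞ f) {x₀ : M} {y : E} (hy : y ∈ (extChartAt I x₀).target)
    (hinj : Function.Injective (differential I f ((extChartAt I x₀).symm y)))
    (hnd : NondegenerateAt (f ∘ (extChartAt I ((extChartAt I x₀).symm y)).symm)
      (extChartAt I ((extChartAt I x₀).symm y) ((extChartAt I x₀).symm y))) :
    NondegenerateAt (f ∘ (extChartAt I x₀).symm) y := by
  set x := (extChartAt I x₀).symm y with hx
  have hxs : x ∈ (extChartAt I x₀).source := (extChartAt I x₀).map_target hy
  have htx : (extChartAt I x).target ∈ nhds (extChartAt I x x) := extChartAt_target_mem_nhds x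
  have hsymm : ContMDiffAt 𝓘(ℝ, E) I ∞ (extChartAt I x).symm (extChartAt I x x) :=
    (contMDiffOn_extChartAt_symm x).contMDiffAt htx
  have hback : (extChartAt I x).symm (extChartAt I x x) = x := extChartAt_to_inv x
  have hψ : ContDiffAt ℝ ∞ (extChartAt I x₀ ∘ (extChartAt I x).symm) (extChartAt I x x) := by
    refine contMDiffAt_iff_contDiffAt.1 (ContMDiffAt.comp _ ?_ hsymm)
    rw [hback]
    exact contMDiffAt_extChartAt' (by rwa [extChartAt_source] at hxs)
  have hψc : (extChartAt I x₀ ∘ (extChartAt I x).symm) (extChartAt I x x) = y := by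
    rw [Function.comp_apply, hback, hx, (extChartAt I x₀).right_inv hy]
  rw [← hψc]
  refine hnd.of_comp ?_ ?_ hψ ?_
  · rwa [← differential_eq_fderiv I.range_eq_univ (hf.mdifferentiableAt (by simp))]
  · rw [hψc]
    exact (contDiffOn_comp_extChartAt_symm hf x₀).contDiffAt
      ((isOpen_extChartAt_target x₀).mem_nhds hy)
  · have : ∀ᶠ z in nhds (extChartAt I x x), (extChartAt I x).symm z ∈ (extChartAt I x₀).source := by
      refine hsymm.continuousAt.eventually ?_
      rw [hback]
      exact (isOpen_extChartAt_source x₀).mem_nhds hxs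
    filter_upwards [this] with z hz
    simp only [Function.comp_apply, (extChartAt I x₀).left_inv hz]

end Charts

theorem IsIsometricImmersion.differential_injective {E : Type*} [NormedAddCommGroup E]
    [NormedSpace ℝ E] {H : Type*} [TopologicalSpace H] {I : ModelWithCorners ℝ E H}
    {M : Type*} [TopologicalSpace M] [ChartedSpace H M]
    {V : Type*} [NormedAddCommGroup V] [InnerProductSpace ℝ V] [IsManifold I 1 M]
    {g : Bundle.ContMDiffRiemannianMetric I ∞ E (fun x : M => TangentSpace I x)} {f : M → V}
    (hf : IsIsometricImmersion I g f) (x : M) : Function.Injective (differential I f x) := by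
  refine (injective_iff_map_eq_zero _).2 fun X hX => ?_
  by_contra h
  have := g.pos x X h
  rw [← hf.2 x X X, hX, inner_zero_left] at this
  exact lt_irrefl _ this

/-! ### From the nullity bounds to nondegeneracy of the factors. -/

section Nullity

variable {r : ℕ} {n p : Fin r → ℕ} {M : Fin r → Type*} [∀ i, TopologicalSpace (M i)]
  [∀ i, ChartedSpace (EuclideanSpace ℝ (Fin (n i))) (M i)]

theorem range_pi_modelWithCornersSelf :
    Set.range (ModelWithCorners.pi fun i => 𝓡 (n i)) = Set.univ :=
  Set.range_eq_univ.2 fun y => ⟨y, rfl⟩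

variable [∀ i, IsManifold (𝓡 (n i)) ∞ (M i)]
  {g : ∀ i, Bundle.ContMDiffRiemannianMetric (𝓡 (n i)) ∞ (EuclideanSpace ℝ (Fin (n i)))
    (fun x : M i => TangentSpace (𝓡 (n i)) x)}
  {f : ∀ i, M i → EuclideanSpace ℝ (Fin (n i + p i))}

theorem finrank_le_sNullity {E : Type*} [NormedAddCommGroup E] [NormedSpace ℝ E]
    [FiniteDimensional ℝ E]
    {H : Type*} [TopologicalSpace H] {I : ModelWithCorners ℝ E H}
    {M : Type*} [TopologicalSpace M] [ChartedSpace H M]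
    {V : Type*} [NormedAddCommGroup V] [InnerProductSpace ℝ V] [FiniteDimensional ℝ V]
    {f : M → V} {x : M} {U : Submodule ℝ V} (hU : U ≤ normalSpace I f x)
    {K : Submodule ℝ (TangentSpace I x)} (hK : K ≤ nullitySpace I f x U) :
    Module.finrank ℝ K ≤ sNullity I f x (Module.finrank ℝ U) := by
  have : FiniteDimensional ℝ (TangentSpace I x) := inferInstanceAs (FiniteDimensional ℝ E)
  refine (Submodule.finrank_mono hK).trans
    (le_csSup ⟨Module.finrank ℝ (TangentSpace I x), ?_⟩ ⟨U, hU, rfl, rfl⟩)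
  rintro d ⟨U', -, -, rfl⟩
  exact Submodule.finrank_le _

theorem mem_nullitySpace_of_inner_chartHessian_eq_zero {E : Type*} [NormedAddCommGroup E]
    [NormedSpace ℝ E]
    {H : Type*} [TopologicalSpace H] {I : ModelWithCorners ℝ E H}
    {M : Type*} [TopologicalSpace M] [ChartedSpace H M]
    {V : Type*} [NormedAddCommGroup V] [InnerProductSpace ℝ V] [FiniteDimensional ℝ V]
    {f : M → V} {x : M} {U : Submodule ℝ V} (hU : U ≤ normalSpace I f x)
    {Y : TangentSpace I x} (hY : ∀ X, ∀ u ∈ U, inner ℝ (chartHessian I f x Y X) u = 0) :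
    Y ∈ nullitySpace I f x U := by
  intro X
  rw [Submodule.starProjection_apply_eq_zero_iff]
  intro u hu
  rw [real_inner_comm]
  change inner ℝ ((normalSpace I f x).starProjection (chartHessian I f x Y X)) u = 0
  rw [Submodule.inner_starProjection_left_eq_right,
    Submodule.starProjection_eq_self_iff.2 (hU hu)]
  exact hY X u hu

/-- A form `B ≠ 0` violating nondegeneracy of one factor, extended by zero to the product, would
have a kernel too large for the `s`-nullity with `s` its rank. -/
theorem nondegenerateAt_of_sNullity
    (hf : ∀ i, IsIsometricImmersion (𝓡 (n i)) (g i) (f i)) (x : ∀ i, M i)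
    (hν : ∀ s : ℕ, 1 ≤ s → s ≤ ∑ i, p i →
      sNullity (ModelWithCorners.pi fun i => 𝓡 (n i)) (extrinsicProduct f) x s <
        (∑ i, n i) - s) (i : Fin r) :
    NondegenerateAt (f i ∘ (extChartAt (𝓡 (n i)) (x i)).symm)
      (extChartAt (𝓡 (n i)) (x i) (x i)) := by
  intro B hB1 hB2
  set I := ModelWithCorners.pi fun i => 𝓡 (n i) with hI
  set F := fun i => f i ∘ (extChartAt (𝓡 (n i)) (x i)).symm with hF
  set c := fun i => extChartAt (𝓡 (n i)) (x i) (x i) with hc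
  have hFs : ∀ i, ContDiffOn ℝ ∞ (F i) (extChartAt (𝓡 (n i)) (x i)).target :=
    fun i => contDiffOn_comp_extChartAt_symm (hf i).1 (x i)
  have hopen : ∀ i, IsOpen (extChartAt (𝓡 (n i)) (x i)).target :=
    fun i => isOpen_extChartAt_target (x i)
  have hcm : ∀ i, c i ∈ (extChartAt (𝓡 (n i)) (x i)).target := fun i => mem_extChartAt_target (x i)
  have hsm : ContMDiff I 𝓘(ℝ, PiLp 2 fun i => EuclideanSpace ℝ (Fin (n i + p i))) ∞
      (extrinsicProduct f) := contMDiff_extrinsicProduct fun i => (hf i).1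
  have hdiff : ∀ (X : ∀ i, EuclideanSpace ℝ (Fin (n i))) (i),
      (differential I (extrinsicProduct f) x X) i = fderiv ℝ (F i) (c i) (X i) := by
    intro X i
    rw [differential_eq_fderiv range_pi_modelWithCornersSelf (hsm.mdifferentiableAt (by simp))]
    exact fderiv_extrinsicProduct_apply
      (fun i => (hFs i).contDiffAt ((hopen i).mem_nhds (hcm i))) X i
  have hhess : ∀ (Y X : ∀ i, EuclideanSpace ℝ (Fin (n i))) (i),
      (chartHessian I (extrinsicProduct f) x Y X) i =
        fderiv ℝ (fderiv ℝ (F i)) (c i) (Y i) (X i) := by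
    intro Y X i
    exact (congrArg (fun v : PiLp 2 fun i => EuclideanSpace ℝ (Fin (n i + p i)) => v i)
      (chartHessian_apply range_pi_modelWithCornersSelf (extrinsicProduct f) x Y X)).trans
        (fderiv_fderiv_extrinsicProduct_apply hopen hcm hFs Y X i)
  let L : (∀ i, EuclideanSpace ℝ (Fin (n i))) →ₗ[ℝ]
      PiLp 2 fun i => EuclideanSpace ℝ (Fin (n i + p i)) :=
    (WithLp.linearEquiv 2 ℝ (∀ i, EuclideanSpace ℝ (Fin (n i + p i)))).symm.toLinearMap ∘ₗ
      LinearMap.single ℝ _ i ∘ₗ B ∘ₗ LinearMap.proj i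
  have hL : ∀ Y, L Y = PiLp.single 2 i (B (Y i)) := fun Y => rfl
  have hU : LinearMap.range L ≤ normalSpace I (extrinsicProduct f) x := by
    rintro _ ⟨Y, rfl⟩
    rw [normalSpace, Submodule.mem_orthogonal]
    rintro _ ⟨X, rfl⟩
    rw [hL, inner_piLp_single]
    refine Eq.trans ?_ (hB1 (X i) (Y i))
    congr 1
    exact hdiff X i
  have hinj : Function.Injective (differential I (extrinsicProduct f) x) := by
    refine (injective_iff_map_eq_zero _).2 fun X hX => ?_
    funext k
    refine (injective_iff_map_eq_zero _).1 ((hf k).differential_injective (x k)) (X k) ?_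
    rw [differential_eq_fderiv (𝓡 (n k)).range_eq_univ ((hf k).1.mdifferentiableAt (by simp))]
    refine (hdiff X k).symm.trans ?_
    rw [hX]; rfl
  have hsum : Module.finrank ℝ (∀ i, EuclideanSpace ℝ (Fin (n i))) = ∑ i, n i := by
    simp [Module.finrank_pi_fintype]
  have hnormal : Module.finrank ℝ (normalSpace I (extrinsicProduct f) x) = ∑ i, p i := by
    have h1 := Submodule.finrank_add_finrank_orthogonal
      (LinearMap.range (differential I (extrinsicProduct f) x).toLinearMap)
    have h2 := LinearMap.finrank_range_of_inj (f := (differential I (extrinsicProduct f) x).toLinearMap) hinj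
    have h3 : Module.finrank ℝ (PiLp 2 fun i => EuclideanSpace ℝ (Fin (n i + p i))) =
        ∑ i, n i + ∑ i, p i := by
      rw [(WithLp.linearEquiv 2 ℝ (∀ i, EuclideanSpace ℝ (Fin (n i + p i)))).finrank_eq]
      simp [Module.finrank_pi_fintype, Finset.sum_add_distrib]
    rw [h2, h3] at h1
    have h4 := h1
    change Module.finrank ℝ (∀ i, EuclideanSpace ℝ (Fin (n i))) +
      Module.finrank ℝ (normalSpace I (extrinsicProduct f) x) = _ at h4
    omega
  -- If `B (Y i) = 0`, the symmetry of `B` exchanges `Y` and `Z` and gives `⟨α(Y, X), L Z⟩ = ⟨α(Z,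
  -- X), L Y⟩ = 0`.
  have hker : LinearMap.ker L ≤ nullitySpace I (extrinsicProduct f) x (LinearMap.range L) := by
    intro Y hY
    have hBY : B (Y i) = 0 := by
      have := congrArg (fun v => v i) (LinearMap.mem_ker.1 hY)
      simpa [hL] using this
    refine mem_nullitySpace_of_inner_chartHessian_eq_zero hU ?_
    rintro X _ ⟨Z, rfl⟩
    rw [hL, inner_piLp_single]
    refine (congrArg (fun v => inner ℝ v (B (Z i))) (hhess Y X i)).trans ?_
    refine (hB2 (Y i) (X i) (Z i)).trans ?_
    rw [hBY, inner_zero_right]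
  by_contra hB
  have hL0 : L ≠ 0 := by
    intro h0
    refine hB (LinearMap.ext fun X => ?_)
    have := congrArg (fun v => v i) (LinearMap.congr_fun h0 (Pi.single i X))
    simpa [hL] using this
  have hs : 1 ≤ Module.finrank ℝ (LinearMap.range L) := by
    rw [Nat.one_le_iff_ne_zero]
    intro h0
    exact hL0 (LinearMap.range_eq_bot.1 (Submodule.finrank_eq_zero.1 h0))
  have hlt := hν _ hs ((Submodule.finrank_mono hU).trans_eq hnormal)
  have hle : Module.finrank ℝ (LinearMap.ker L) ≤
      sNullity I (extrinsicProduct f) x (Module.finrank ℝ (LinearMap.range L)) :=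
    finrank_le_sNullity hU hker
  -- By rank-nullity `dim ker L = n - s`, while `dim ker L ≤ ν_s < n - s`.
  have hrn := LinearMap.finrank_range_add_finrank_ker L
  rw [hsum] at hrn
  omega

end Nullity

/-! ### Splitting a product bending into components. -/

section Transfer

variable {ι : Type*} [Fintype ι] [DecidableEq ι]
  {E : ι → Type*} [∀ i, NormedAddCommGroup (E i)] [∀ i, NormedSpace ℝ (E i)]
  {V : ι → Type*} [∀ i, NormedAddCommGroup (V i)] [∀ i, InnerProductSpace ℝ (V i)]

/-- The components of an infinitesimal bending of a product of maps over a box. -/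
theorem isBoxBending_of_inner_fderiv {F : ∀ i, E i → V i} {P : (∀ i, E i) → PiLp 2 V}
    {W : ∀ i, Set (E i)} (hW : ∀ i, IsOpen (W i)) (hc : ∀ i, Convex ℝ (W i))
    (hF : ∀ i, ContDiffOn ℝ ∞ (F i) (W i)) (hP : ContDiffOn ℝ ∞ P (Set.univ.pi W))
    (hnd : ∀ i, ∀ y ∈ W i, NondegenerateAt (F i) y)
    (hb : ∀ y ∈ Set.univ.pi W, ∀ X Y,
      inner ℝ (fderiv ℝ P y X) (fderiv ℝ (extrinsicProduct F) y Y) +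
        inner ℝ (fderiv ℝ (extrinsicProduct F) y X) (fderiv ℝ P y Y) = 0) :
    IsBoxBending F (fun i y => P y i) W := by
  have hbox : IsOpen (Set.univ.pi W) := isOpen_set_pi Set.finite_univ fun i _ => hW i
  have hF' : ∀ y ∈ Set.univ.pi W, ∀ i, ContDiffAt ℝ ∞ (F i) (y i) :=
    fun y hy i => (hF i).contDiffAt ((hW i).mem_nhds (hy i trivial))
  have hsingle : ∀ y ∈ Set.univ.pi W, ∀ i X,
      fderiv ℝ (extrinsicProduct F) y (Pi.single i X) =
        PiLp.single 2 i (fderiv ℝ (F i) (y i) X) := by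
    intro y hy i X
    ext1 k
    rw [fderiv_extrinsicProduct_apply (hF' y hy)]
    by_cases hk : k = i
    · subst hk; simp
    · simp [hk]
  have hPd : ∀ y ∈ Set.univ.pi W, ∀ X i, fderiv ℝ P y X i = fderiv ℝ (fun z => P z i) y X :=
    fun y hy X i => fderiv_piLp_apply (differentiableAt_of_contDiffOn_isOpen hbox hP hy) X i
  have hmixed : ∀ y ∈ Set.univ.pi W, ∀ i j X Y,
      inner ℝ (fderiv ℝ (fun z => P z j) y (Pi.single i X)) (fderiv ℝ (F j) (y j) Y) +
        inner ℝ (fderiv ℝ (F i) (y i) X) (fderiv ℝ (fun z => P z i) y (Pi.single j Y)) = 0 := by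
    intro y hy i j X Y
    have := hb y hy (Pi.single i X) (Pi.single j Y)
    rw [hsingle y hy, hsingle y hy, inner_piLp_single,
      real_inner_comm (fderiv ℝ P y (Pi.single j Y)), inner_piLp_single, hPd y hy, hPd y hy] at this
    rwa [real_inner_comm (fderiv ℝ (F i) (y i) X)] at this
  exact ⟨hW, hc, hF, fun i => (contDiffOn_piLp 2).1 hP i, hnd,
    fun y hy i X Z => hmixed y hy i i X Z, fun y hy i j _ X Y => hmixed y hy i j X Y⟩

end Transfer

/-! ### Passing from the product manifold to coordinates. -/

section InverseCharts

variable {ι : Type*} [Fintype ι]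
  {E : ι → Type*} [∀ i, NormedAddCommGroup (E i)] [∀ i, NormedSpace ℝ (E i)]
  {H : ι → Type*} [∀ i, TopologicalSpace (H i)] {I : ∀ i, ModelWithCorners ℝ (E i) (H i)}
  [∀ i, (I i).Boundaryless]
  {M : ι → Type*} [∀ i, TopologicalSpace (M i)] [∀ i, ChartedSpace (H i) (M i)]
  [∀ i, IsManifold (I i) ∞ (M i)]

/-- Product of the inverses of the preferred charts at the components of `x₀`. -/
def inverseCharts (I : ∀ i, ModelWithCorners ℝ (E i) (H i)) (x₀ : ∀ i, M i) (y : ∀ i, E i) :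
    ∀ i, M i :=
  fun i => (extChartAt (I i) (x₀ i)).symm (y i)

theorem contMDiffAt_inverseCharts (x₀ : ∀ i, M i) {y : ∀ i, E i}
    (hy : ∀ i, y i ∈ (extChartAt (I i) (x₀ i)).target) :
    ContMDiffAt 𝓘(ℝ, ∀ i, E i) (ModelWithCorners.pi I) ∞ (inverseCharts I x₀) y := by
  refine contMDiffAt_pi_of_forall fun i => ?_
  have h1 : ContMDiffAt 𝓘(ℝ, E i) (I i) ∞ (extChartAt (I i) (x₀ i)).symm (y i) :=
    (contMDiffOn_extChartAt_symm (x₀ i)).contMDiffAt (extChartAt_target_mem_nhds' (hy i))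
  exact h1.comp y (contMDiffAt_pi_space.1 contMDiffAt_id i)

theorem fderiv_comp_inverseCharts {V : Type*} [NormedAddCommGroup V] [InnerProductSpace ℝ V]
    {T : (∀ i, M i) → V} (hT : ContMDiff (ModelWithCorners.pi I) 𝓘(ℝ, V) ∞ T) (x₀ : ∀ i, M i)
    {y : ∀ i, E i} (hy : ∀ i, y i ∈ (extChartAt (I i) (x₀ i)).target) (X : ∀ i, E i) :
    fderiv ℝ (T ∘ inverseCharts I x₀) y X =
      differential (ModelWithCorners.pi I) T (inverseCharts I x₀ y)
        (mfderiv 𝓘(ℝ, ∀ i, E i) (ModelWithCorners.pi I) (inverseCharts I x₀) y X) := by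
  rw [← mfderiv_eq_fderiv, mfderiv_comp y (hT.mdifferentiableAt (by simp))
    ((contMDiffAt_inverseCharts x₀ hy).mdifferentiableAt (by simp))]
  rfl

theorem contDiffOn_comp_inverseCharts {V : Type*} [NormedAddCommGroup V] [InnerProductSpace ℝ V]
    {T : (∀ i, M i) → V} (hT : ContMDiff (ModelWithCorners.pi I) 𝓘(ℝ, V) ∞ T) (x₀ : ∀ i, M i) :
    ContDiffOn ℝ ∞ (T ∘ inverseCharts I x₀)
      (Set.univ.pi fun i => (extChartAt (I i) (x₀ i)).target) := fun y hy =>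
  (contMDiffAt_iff_contDiffAt.1 ((hT _).comp y (contMDiffAt_inverseCharts x₀
    fun i => hy i trivial))).contDiffWithinAt

end InverseCharts

/-! ### Passing from coordinates back to the factors. -/

section PullBack

variable {E : Type*} [NormedAddCommGroup E] [NormedSpace ℝ E]
  {H : Type*} [TopologicalSpace H] {I : ModelWithCorners ℝ E H}
  {M : Type*} [TopologicalSpace M] [ChartedSpace H M] [IsManifold I ∞ M]
  {V : Type*} [NormedAddCommGroup V] [InnerProductSpace ℝ V]

/-- An infinitesimal bending of a map in a chart is one of the map on the manifold. -/
theorem isInfinitesimalBendingOn_comp_extChartAt [I.Boundaryless] {f : M → V} {x₀ : M}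
    (hf : ContMDiff I 𝓘(ℝ, V) ∞ f)
    {τ : E → V} {W : Set E} (hW : IsOpen W) (hWt : W ⊆ (extChartAt I x₀).target)
    (hτ : ContDiffOn ℝ ∞ τ W)
    (hb : ∀ y ∈ W, ∀ X Y,
      inner ℝ (fderiv ℝ τ y X) (fderiv ℝ (f ∘ (extChartAt I x₀).symm) y Y) +
        inner ℝ (fderiv ℝ (f ∘ (extChartAt I x₀).symm) y X) (fderiv ℝ τ y Y) = 0) :
    IsInfinitesimalBendingOn I f (τ ∘ extChartAt I x₀)
      ((extChartAt I x₀).source ∩ extChartAt I x₀ ⁻¹' W) := by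
  have hφ : ∀ z ∈ (extChartAt I x₀).source, ContMDiffAt I 𝓘(ℝ, E) ∞ (extChartAt I x₀) z :=
    fun z hz => contMDiffAt_extChartAt' (by rwa [extChartAt_source] at hz)
  have chain : ∀ (g : E → V) (z : M), z ∈ (extChartAt I x₀).source →
      DifferentiableAt ℝ g (extChartAt I x₀ z) → ∀ X : TangentSpace I z,
      differential I (g ∘ extChartAt I x₀) z X =
        fderiv ℝ g (extChartAt I x₀ z) (mfderiv I 𝓘(ℝ, E) (extChartAt I x₀) z X) := by
    intro g z hz hg X
    rw [differential, mfderiv_comp z hg.mdifferentiableAt ((hφ z hz).mdifferentiableAt (by simp)),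
      mfderiv_eq_fderiv]
    rfl
  refine ⟨fun z hz => ?_, fun z hz X Y => ?_⟩
  · have h1 : ContMDiffAt 𝓘(ℝ, E) 𝓘(ℝ, V) ∞ τ (extChartAt I x₀ z) :=
      (hτ.contDiffAt (hW.mem_nhds hz.2)).contMDiffAt
    exact (h1.comp z (hφ z hz.1)).contMDiffWithinAt
  · have hτd := differentiableAt_of_contDiffOn_isOpen hW hτ hz.2
    have hfd := differentiableAt_of_contDiffOn_isOpen hW
      ((contDiffOn_comp_extChartAt_symm hf x₀).mono hWt) hz.2
    have hfeq : differential I f z =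
        differential I ((f ∘ (extChartAt I x₀).symm) ∘ extChartAt I x₀) z := by
      refine Filter.EventuallyEq.mfderiv_eq ?_
      filter_upwards [(isOpen_extChartAt_source (I := I) x₀).mem_nhds hz.1] with w hw
      simp only [Function.comp_apply, (extChartAt I x₀).left_inv hw]
    rw [hfeq, chain _ z hz.1 hτd, chain _ z hz.1 hτd, chain _ z hz.1 hfd, chain _ z hz.1 hfd]
    exact hb _ hz.2 _ _

end PullBack

end InfinitesimalBending

end

/-! ### The local decomposition on the manifold. -/

theorem mainTheorem4 {r : ℕ} (n p : Fin r → ℕ)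
    (M : Fin r → Type*) [∀ i, TopologicalSpace (M i)]
    [∀ i, ChartedSpace (EuclideanSpace ℝ (Fin (n i))) (M i)]
    [∀ i, IsManifold (𝓡 (n i)) ∞ (M i)]
    (g : ∀ i, Bundle.ContMDiffRiemannianMetric (𝓡 (n i)) ∞ (EuclideanSpace ℝ (Fin (n i)))
      (fun x : M i => TangentSpace (𝓡 (n i)) x))
    (f : ∀ i, M i → EuclideanSpace ℝ (Fin (n i + p i)))
    (hf : ∀ i, InfinitesimalBending.IsIsometricImmersion (𝓡 (n i)) (g i) (f i))
    (hn : ∀ i, 2 ≤ n i)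
    (hpn : ∑ i, p i < ∑ i, n i)
    (hν : ∀ (x : ∀ i, M i) (s : ℕ), 1 ≤ s → s ≤ ∑ i, p i →
      InfinitesimalBending.sNullity (ModelWithCorners.pi fun i => 𝓡 (n i))
        (InfinitesimalBending.extrinsicProduct f) x s < (∑ i, n i) - s)
    (T : (∀ i, M i) → PiLp 2 fun i => EuclideanSpace ℝ (Fin (n i + p i)))
    (hT : InfinitesimalBending.IsInfinitesimalBending (ModelWithCorners.pi fun i => 𝓡 (n i))
      (InfinitesimalBending.extrinsicProduct f) T)
    (x₀ : ∀ i, M i) :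
    ∃ (U : ∀ i, Set (M i)) (τ : ∀ i, M i → EuclideanSpace ℝ (Fin (n i + p i)))
      (S : (∀ i, M i) → PiLp 2 fun i => EuclideanSpace ℝ (Fin (n i + p i))),
      (∀ i, IsOpen (U i) ∧ x₀ i ∈ U i) ∧
      (∀ i, InfinitesimalBending.IsInfinitesimalBendingOn (𝓡 (n i)) (f i) (τ i) (U i)) ∧
      InfinitesimalBending.IsTrivialBending (InfinitesimalBending.extrinsicProduct f) S ∧
      ∀ x : ∀ i, M i, (∀ i, x i ∈ U i) →
        T x = (∑ i, PiLp.single 2 i (τ i (x i))) + S x := by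
  set F := fun i => f i ∘ (extChartAt (𝓡 (n i)) (x₀ i)).symm with hF
  set o := fun i => extChartAt (𝓡 (n i)) (x₀ i) (x₀ i) with ho
  set P := T ∘ InfinitesimalBending.inverseCharts (fun i => 𝓡 (n i)) x₀ with hP
  have hball : ∀ i, ∃ ε > 0, Metric.ball (o i) ε ⊆ (extChartAt (𝓡 (n i)) (x₀ i)).target :=
    fun i => Metric.mem_nhds_iff.1 (extChartAt_target_mem_nhds (x₀ i))
  choose ε hε hεt using hball
  set W := fun i => Metric.ball (o i) (ε i) with hW
  have hoW : o ∈ Set.univ.pi W := fun i _ => Metric.mem_ball_self (hε i)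
  have hWo : ∀ i, IsOpen (W i) := fun i => Metric.isOpen_ball
  have hTs : ContMDiff (ModelWithCorners.pi fun i => 𝓡 (n i))
      𝓘(ℝ, PiLp 2 fun i => EuclideanSpace ℝ (Fin (n i + p i))) ∞ T :=
    contMDiffOn_univ.1 hT.1
  have hfs := InfinitesimalBending.contMDiff_extrinsicProduct fun i => (hf i).1
  have hnt : ∀ i, Nontrivial (EuclideanSpace ℝ (Fin (n i))) := fun i =>
    Module.nontrivial_of_finrank_pos (R := ℝ) (by have := hn i; simp; omega)
  have hbox : InfinitesimalBending.IsBoxBending F (fun i y => P y i) W := by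
    refine InfinitesimalBending.isBoxBending_of_inner_fderiv hWo (fun i => convex_ball _ _)
      (fun i => (InfinitesimalBending.contDiffOn_comp_extChartAt_symm (hf i).1 (x₀ i)).mono (hεt i))
      ((InfinitesimalBending.contDiffOn_comp_inverseCharts hTs x₀).mono
        (Set.pi_mono fun i _ => hεt i)) ?_ ?_
    · intro i y hy
      refine InfinitesimalBending.nondegenerateAt_of_extChartAt_self (hf i).1 (hεt i hy)
        ((hf i).differential_injective _) ?_
      -- Nondegeneracy of the `i`-th factor depends only on the `i`-th component, so the other
      -- components may stay at `x₀`.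
      have := InfinitesimalBending.nondegenerateAt_of_sNullity hf
        (Function.update x₀ i ((extChartAt (𝓡 (n i)) (x₀ i)).symm y)) (hν _) i
      rwa [Function.update_self] at this
    · intro y hy X Y
      have hyt : ∀ i, y i ∈ (extChartAt (𝓡 (n i)) (x₀ i)).target := fun i => hεt i (hy i trivial)
      have e : InfinitesimalBending.extrinsicProduct F =
        InfinitesimalBending.extrinsicProduct f ∘
          InfinitesimalBending.inverseCharts (fun i => 𝓡 (n i)) x₀ := rfl
      rw [e, hP, InfinitesimalBending.fderiv_comp_inverseCharts hTs x₀ hyt,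
        InfinitesimalBending.fderiv_comp_inverseCharts hTs x₀ hyt,
        InfinitesimalBending.fderiv_comp_inverseCharts hfs x₀ hyt,
        InfinitesimalBending.fderiv_comp_inverseCharts hfs x₀ hyt]
      exact hT.2 _ trivial _ _
  obtain ⟨D, hD, hDP⟩ := hbox.exists_skew hoW
  -- The bending of the `i`-th factor is the `i`-th component of `T` on the slice through `x₀`.
  -- Since `D` acts on chords from `x₀`, the translation part of the trivial bending is `-D (f x₀)`.
  refine ⟨fun i => (extChartAt (𝓡 (n i)) (x₀ i)).source ∩ extChartAt (𝓡 (n i)) (x₀ i) ⁻¹' W i,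
    fun i => (fun z => P (Function.update o i z) i) ∘ extChartAt (𝓡 (n i)) (x₀ i),
    fun x => D (InfinitesimalBending.extrinsicProduct f x) +
      -D (InfinitesimalBending.extrinsicProduct f x₀), fun i => ⟨?_, ?_⟩, fun i => ?_,
    ⟨D, _, hD, fun x => rfl⟩, fun x hx => ?_⟩
  · exact isOpen_extChartAt_preimage' (x₀ i) (hWo i)
  · exact ⟨mem_extChartAt_source (x₀ i), hoW i trivial⟩
  · refine InfinitesimalBending.isInfinitesimalBendingOn_comp_extChartAt (hf i).1 (hWo i) (hεt i)
      (InfinitesimalBending.IsBoxBending.contDiffOn_comp_update (hbox.smooth_bending i) hoW i) ?_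
    intro y hy X Y
    have hm := InfinitesimalBending.update_mem_box hoW hy
    have hd := hbox.differentiableAt_bending i hm
    rw [InfinitesimalBending.IsBoxBending.fderiv_comp_update (g := fun y => P y i) hd,
      InfinitesimalBending.IsBoxBending.fderiv_comp_update (g := fun y => P y i) hd]
    have := hbox.diag _ hm i X Y
    rwa [Function.update_self] at this
  · set y := fun i => extChartAt (𝓡 (n i)) (x₀ i) (x i) with hy
    have hyW : y ∈ Set.univ.pi W := fun i _ => (hx i).2
    have hback : InfinitesimalBending.inverseCharts (fun i => 𝓡 (n i)) x₀ y = x :=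
      funext fun i => (extChartAt (𝓡 (n i)) (x₀ i)).left_inv (hx i).1
    have hFy : (WithLp.toLp 2 fun j => F j (y j) - F j (o j)) =
        InfinitesimalBending.extrinsicProduct f x - InfinitesimalBending.extrinsicProduct f x₀ := by
      ext1 j
      have h1 : F j (y j) = f j (x j) :=
        congrArg (f j) ((extChartAt (𝓡 (n j)) (x₀ j)).left_inv (hx j).1)
      have h2 : F j (o j) = f j (x₀ j) := congrArg (f j) (extChartAt_to_inv (x₀ j))
      change F j (y j) - F j (o j) = f j (x j) - f j (x₀ j)
      rw [h1, h2]
    have hsum : ∀ (v : ∀ i, EuclideanSpace ℝ (Fin (n i + p i))) (i),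
        (∑ j, PiLp.single 2 j (v j) : PiLp 2 fun i => EuclideanSpace ℝ (Fin (n i + p i))) i =
          v i := by
      intro v i
      rw [WithLp.ofLp_sum, Finset.sum_apply, Finset.sum_eq_single i]
      · simp
      · intro j _ hj; simp [hj.symm]
      · simp
    ext1 i
    have := hDP y hyW i
    rw [hFy, map_sub] at this
    have hPy : P y = T x := congrArg T hback
    rw [← hPy, this, PiLp.add_apply, hsum, sub_eq_add_neg]
    rfl
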